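/- Let $f:\mathbb R^d\to\mathbb R$ be differentiable, with gradient Lipschitz on every compact set, and suppose that $f$ attains its minimum $f^*$. Let $\mathcal X\subset\{f=f^*\}$ be compact, and for $r>0$ let $N_r(\mathcal X)=\{x:\mathrm{dist}(x,\mathcal X)\le r\}$. Let $\Pi_{\mathcal X}(x)$ be the set of points of $\mathcal X$ nearest to $x$. Let $\nu$ be a probability measure on a measurable space $S$ and let the noise $\xi:\mathbb R^d\times S\to\mathbb R^d$ be measurable with $\int\xi(x,s)\,d\nu(s)=0$ for all $x$ and $\sup_{x\in K}\int\|\xi(x,s)\|^2d\nu(s)<\infty$ for all compact $K$. Let the learning rates satisfy $a_n>0$, $\sum_{n\ge1}a_n=\infty$, $\sum_{n\ge1}a_n^2<\infty$, let $I\ge1$ be the batch size, and consider SGD started at a given point $x_1\in N_r(\mathcal X)$, $$x_{n+1}=x_n-a_n\Big(\nabla f(x_n)+\frac1I\sum_{i=1}^I\xi(x_n,\omega_{n,i})\Big),\qquad \omega_{n,i}\ \text{i.i.d. with law }\nu .$$ Let $L_r>0$ be a Lipschitz constant of $\nabla f$ on $N_r(\mathcal X)$, let $\sigma_r>0$ satisfy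 $\int\|\xi(x,s)\|^2d\nu(s)\le\sigma_r$ for $x\in N_r(\mathcal X)$, and put $$b_n=\prod_{j=1}^{n-1}(1+L_r^2a_j^2),\qquad C_N=\frac{b_N}{r^2}\Big(\mathrm{dist}(x_1,\mathcal X)^2+\frac{\sigma_r}{I}\sum_{n=1}^{N-1}\frac{a_n^2}{b_{n+1}}\Big).$$ **General bound.** Suppose that $h$ satisfies $0\le h(x)\le\langle\nabla f(x),x-p\rangle$ for all $x\in N_r(\mathcal X)$ and all $p\in\Pi_{\mathcal X}(x)$ (the values of $h$ outside $N_r(\mathcal X)$ are arbitrary). Then for all $\epsilon>0$ and $N\ge1$, $$\mathbb P\Big\{\min_{1\le n\le N}h(x_n)>\epsilon\Big\}\le\frac1\epsilon\cdot\frac{\mathrm{dist}(x_1,\mathcal X)^2+\frac{\sigma_r}{I}\sum_{n=1}^N\frac{a_n^2}{b_{n+1}}}{2\sum_{n=1}^N\frac{a_n}{b_{n+1}}}+C_{N+1}.$$ Now let $a_n=a/n^\beta$ with $a>0$ and $\beta\in(1/2,1)$. Below, $K$ is a constant that does not depend on $\epsilon$ and $N$. **(i)** (WQC) If for some $\zeta\in(0,1]$,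 $\langle\nabla f(x),x-p\rangle\ge\zeta(f(x)-f^*)$ for all $x\in N_r(\mathcal X)$ and $p\in\Pi_{\mathcal X}(x)$, then there is $K$ such that for all $\epsilon>0$ and $N\ge1$, $$\mathbb P\Big\{\min_{1\le n\le N}f(x_n)-f^*>\epsilon\Big\}\le\frac{K}{\epsilon N^{1-\beta}}+C_{N+1}.$$ **(ii)** (LRSI) If for some $\mu>0$, $\langle\nabla f(x),x-p\rangle\ge\mu\|x-p\|^2$ for all $x\in N_r(\mathcal X)$ and $p\in\Pi_{\mathcal X}(x)$, then there is $K$ such that for all $\epsilon>0$ and $N\ge1$, $$\mathbb P\{f(x_N)-f^*>\epsilon\}\le\frac{K}{\epsilon N^{\beta}}+C_{N+1}.$$ (HCPRC) Suppose that there are an open set $U\subset\mathbb R^d$ and $k\in\{0,\dots,d-1\}$ such that $\mathcal X=\{f=f^*\}\cap U$ is a non-empty compact $k$-dimensional $C^2$ submanifold of $\mathbb R^d$ without boundary, $f\in C^3(U)$, and $\operatorname{rank}\nabla^2f(x)=d-k$ for all $x\in\mathcal X$. Then there is $r_0>0$, determined by $f$ and $\mathcal X$, such that the same bound holds for every $r\in(0,r_0]$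 and every SGD iteration as above started in $N_r(\mathcal X)$. -/

import Mathlib

open MeasureTheory ProbabilityTheory

noncomputable section

/-- The parameter space `ℝᵈ` with the Euclidean norm. -/
abbrev RSpace (d : ℕ) : Type := EuclideanSpace ℝ (Fin d)

/-- `N_r(X)`: the closed `r`-neighborhood of `X`, that is `{x | dist(x, X) ≤ r}`. -/
def closedNbhd {d : ℕ} (r : ℝ) (X : Set (RSpace d)) : Set (RSpace d) :=
  Metric.cthickening r X

/-- The set-valued metric projection `Π_X(x)`. -/
def metricProj {d : ℕ} (X : Set (RSpace d)) (x : RSpace d) : Set (RSpace d) :=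
  {z | z ∈ X ∧ ‖x - z‖ = Metric.infDist x X}

/-- `f` is differentiable and its gradient is Lipschitz on every compact set. -/
def LocLipGradient {d : ℕ} (f : RSpace d → ℝ) : Prop :=
  Differentiable ℝ f ∧
    ∀ K : Set (RSpace d), IsCompact K → ∃ LK : ℝ, 0 < LK ∧
      ∀ x ∈ K, ∀ y ∈ K, ‖gradient f x - gradient f y‖ ≤ LK * ‖x - y‖

/-- The gradient noise `ξ(x, s)`, where the sample `s` has law `ν`: it is centered for every `x`,
and its second moment is bounded on compact sets. -/
structure NoiseAssumption {d : ℕ} {S : Type*} [MeasurableSpace S] (ν : Measure S)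
    (ξ : RSpace d → S → RSpace d) : Prop where
  measurable : Measurable (Function.uncurry ξ)
  memLp : ∀ x, MemLp (ξ x) 2 ν
  centered : ∀ x, ∫ s, ξ x s ∂ν = 0
  bounded : ∀ K : Set (RSpace d), IsCompact K → ∃ σK : ℝ, 0 < σK ∧
    ∀ x ∈ K, ∫ s, ‖ξ x s‖ ^ 2 ∂ν ≤ σK

/-- Learning rates `a₁, a₂, …`: positive, with divergent sum and summable squares
(the value `a 0` is not used). -/
structure StepSizes (a : ℕ → ℝ) : Prop where
  pos : ∀ n, 1 ≤ n → 0 < a n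
  sum_diverges : ¬ Summable (fun n => a (n + 1))
  sum_sq : Summable (fun n => a (n + 1) ^ 2)

/-- `x` (indexed from `1`) is the SGD iteration with batch size `I`, learning rates `a`, and
initial point `x₁`: at each step `n ≥ 1` the noise is the average of `ξ (x n)` over a fresh batch
of `I` samples, all samples being independent with law `ν`. For `I = 1` this is
`x_{n+1} = x_n - a_n (∇f(x_n) + ξ_n)`. -/
def IsSGD {d : ℕ} {Ω S : Type*} [MeasurableSpace Ω] [MeasurableSpace S] (P : Measure Ω)
    (ν : Measure S) (f : RSpace d → ℝ) (ξ : RSpace d → S → RSpace d) (I : ℕ) (a : ℕ → ℝ)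
    (x₁ : RSpace d) (x : ℕ → Ω → RSpace d) : Prop :=
  ∃ s : ℕ → Fin I → Ω → S,
    (∀ n, 1 ≤ n → ∀ i, Measurable (s n i) ∧ P.map (s n i) = ν) ∧
    iIndepFun (fun p : ℕ × Fin I => s (p.1 + 1) p.2) P ∧
    (∀ ω, x 1 ω = x₁) ∧
    ∀ n, 1 ≤ n → ∀ ω, x (n + 1) ω =
      x n ω - a n • (gradient f (x n ω) + (I : ℝ)⁻¹ • ∑ i, ξ (x n ω) (s n i ω))

/-- The stochastic setting around `N_r(X)`: noise assumption, learning rates, the constants `L`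
(Lipschitz constant of `∇f` on `N_r(X)`) and `σ` (bound of the second moment of the noise on
`N_r(X)`), and the SGD iteration started from `x₁ ∈ N_r(X)`. -/
structure SGDSetting {d : ℕ} {Ω S : Type*} [MeasurableSpace Ω] [MeasurableSpace S]
    (P : Measure Ω) (ν : Measure S) (f : RSpace d → ℝ) (X : Set (RSpace d)) (r L σ : ℝ)
    (ξ : RSpace d → S → RSpace d) (I : ℕ) (a : ℕ → ℝ) (x₁ : RSpace d)
    (x : ℕ → Ω → RSpace d) : Prop where
  noise : NoiseAssumption ν ξ
  steps : StepSizes a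
  batch_pos : 1 ≤ I
  L_pos : 0 < L
  lipschitz : ∀ y ∈ closedNbhd r X, ∀ z ∈ closedNbhd r X,
    ‖gradient f y - gradient f z‖ ≤ L * ‖y - z‖
  σ_pos : 0 < σ
  variance : ∀ y ∈ closedNbhd r X, ∫ s, ‖ξ y s‖ ^ 2 ∂ν ≤ σ
  init : x₁ ∈ closedNbhd r X
  sgd : IsSGD P ν f ξ I a x₁ x

/-- Non-negative support condition (NNS) with support function `h`. Only the values of `h` on
`N_r(X)` matter. -/
def NNS {d : ℕ} (f : RSpace d → ℝ) (X : Set (RSpace d)) (r : ℝ) (h : RSpace d → ℝ) : Prop :=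
  ∀ x ∈ closedNbhd r X, 0 ≤ h x ∧
    ∀ p ∈ metricProj X x, h x ≤ inner ℝ (gradient f x) (x - p)

/-- Weak quasar-convexity (WQC) on `N_r(X)`. -/
def WQC {d : ℕ} (f : RSpace d → ℝ) (fstar : ℝ) (X : Set (RSpace d)) (r : ℝ) : Prop :=
  ∃ ζ : ℝ, 0 < ζ ∧ ζ ≤ 1 ∧ ∀ x ∈ closedNbhd r X, ∀ p ∈ metricProj X x,
    ζ * (f x - fstar) ≤ inner ℝ (gradient f x) (x - p)

/-- Local restricted secant inequality (LRSI) on `N_r(X)`. -/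
def LRSI {d : ℕ} (f : RSpace d → ℝ) (X : Set (RSpace d)) (r : ℝ) : Prop :=
  ∃ μ : ℝ, 0 < μ ∧ ∀ x ∈ closedNbhd r X, ∀ p ∈ metricProj X x,
    μ * ‖x - p‖ ^ 2 ≤ inner ℝ (gradient f x) (x - p)

/-- `M` is a `k`-dimensional (embedded, boundaryless) `C²` submanifold of `ℝᵈ`: near each of its
points a `C²` diffeomorphism between open sets of `ℝᵈ` maps `M` onto the subspace on which
all coordinates but the first `k` vanish. -/
def IsC2Submanifold {d : ℕ} (k : ℕ) (M : Set (RSpace d)) : Prop :=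
  ∀ p ∈ M, ∃ φ : OpenPartialHomeomorph (RSpace d) (RSpace d), p ∈ φ.source ∧
    ContDiffOn ℝ 2 φ φ.source ∧ ContDiffOn ℝ 2 φ.symm φ.target ∧
    ∀ y ∈ φ.source, y ∈ M ↔ ∀ i : Fin d, k ≤ (i : ℕ) → φ y i = 0

/-- The Hessian of `f` at `x`, as the derivative of the gradient. -/
def hessian {d : ℕ} (f : RSpace d → ℝ) (x : RSpace d) : RSpace d →L[ℝ] RSpace d :=
  fderiv ℝ (gradient f) x

/-- Hessian of constant positive rank on a compact submanifold (HCPRC): for some open set `U`,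
`X = {f = fstar} ∩ U` is a non-empty compact `k`-dimensional `C²` submanifold, `0 ≤ k ≤ d - 1`,
`f` is `C³` on `U`, and the Hessian of `f` has rank `d - k` at each point of `X`. -/
def HCPRC {d : ℕ} (f : RSpace d → ℝ) (fstar : ℝ) (X : Set (RSpace d)) : Prop :=
  ∃ (U : Set (RSpace d)) (k : ℕ), IsOpen U ∧ k < d ∧ X = {x | f x = fstar} ∩ U ∧
    X.Nonempty ∧ IsCompact X ∧ IsC2Submanifold k X ∧ ContDiffOn ℝ 3 f U ∧
    ∀ x ∈ X, Module.finrank ℝ (LinearMap.range (hessian f x : RSpace d →ₗ[ℝ] RSpace d)) = d - k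

/-- `b_n = ∏_{j=1}^{n-1} (1 + L² a_j²)`, with `b_1 = 1`. -/
def bSeq (L : ℝ) (a : ℕ → ℝ) (n : ℕ) : ℝ :=
  ∏ j ∈ Finset.Ico 1 n, (1 + L ^ 2 * a j ^ 2)

/-- `dist(x₁, X)² + (σ / I) ∑_{n=1}^{N-1} a_n² / b_{n+1}`. -/
def lyapunovInit {d : ℕ} (X : Set (RSpace d)) (L σ : ℝ) (I : ℕ) (a : ℕ → ℝ) (x₁ : RSpace d)
    (N : ℕ) : ℝ :=
  Metric.infDist x₁ X ^ 2 + σ / (I : ℝ) * ∑ n ∈ Finset.Ico 1 N, a n ^ 2 / bSeq L a (n + 1)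

/-- `C_N = (b_N / r²) (dist(x₁, X)² + (σ / I) ∑_{n=1}^{N-1} a_n² / b_{n+1})`. -/
def exitBound {d : ℕ} (X : Set (RSpace d)) (r L σ : ℝ) (I : ℕ) (a : ℕ → ℝ) (x₁ : RSpace d)
    (N : ℕ) : ℝ :=
  bSeq L a N / r ^ 2 * lyapunovInit X L σ I a x₁ N

/-- `min_{1 ≤ n ≤ N} u_n`, for `N ≥ 1`. -/
def minUpTo (u : ℕ → ℝ) (N : ℕ) (hN : 1 ≤ N) : ℝ :=
  (Finset.Icc 1 N).inf' (Finset.nonempty_Icc.2 hN) u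

end

/-!
The squared distance `D(x) = dist(x, X)²` serves as a Lyapunov function. For `x ∈ N_r(X)` and a
nearest point `p ∈ Π_X(x)`, expanding `‖x - a (∇f(x) + η) - p‖²` and averaging over the centered
batch noise `η`, whose second moment is at most `σ / I`, gives
`E[D(x_{n+1}) | x_n] ≤ (1 + L² a_n²) D(x_n) - 2 a_n ⟨∇f(x_n), x_n - p⟩ + a_n² σ / I`,
because `‖∇f(x)‖ ≤ L ‖x - p‖`. The left side is a measurable function of `x_n` and the inequality
holds for each nearest point separately, so neither a measurable selection of `p` nor
measurability of the support function `h` is required (`SGDSetting.exists_conditional_step`).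

Integrating over the event that the iterates have not yet left `N_r(X)` and dividing by `b_{n+1}`
makes the inequality telescope. An exit at step `n + 1` takes away mass at least `r²` of `D`, so the
same inequality bounds both the probability of exit, by `C_N`, and the accumulated drift
(`SGDSetting.lyapunov_inequality`). Markov's inequality for the drift yields the general bound.

With `a_n = a / n^β`, weak quasar-convexity is the case `h = ζ (f - f*)`, and the sum of the
`a_n / b_{n+1}` is at least of order `N^{1 - β}`. Under the restricted secant inequality the
integral of `D(x_n)` before exit obeys `e_{n+1} ≤ (1 - 2 μ a_n + L² a_n²) e_n + a_n² σ / I`, hence is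
of order `a_n` (`exists_le_div_rpow_of_recursion`), and `f - f* ≤ L D` on `N_r(X)`.

If `X` is a compact manifold of minimizers along which the Hessian has rank `d - k`, the kernel of
the Hessian is exactly the tangent space, while `x - p` is normal to `X` at `p`. The Hessian is
positive semidefinite, so it is positive definite on normal vectors, and a compactness argument
gives the restricted secant inequality near `X` (`HCPRC.exists_LRSI`).
-/

/-! ### Critical points, nearest points and one noisy gradient step -/

lemma gradient_eq_zero_of_isLeast {d : ℕ} {f : RSpace d → ℝ} {fstar : ℝ}
    (hmin : IsLeast (Set.range f) fstar) {p : RSpace d} (hp : f p = fstar) :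
    gradient f p = 0 := by
  have hloc : IsLocalMin f p :=
    Filter.Eventually.of_forall fun y => hp ▸ hmin.2 (Set.mem_range_self y)
  simp [gradient, hloc.fderiv_eq_zero]

lemma LocLipGradient.continuous_gradient {d : ℕ} {f : RSpace d → ℝ} (hf : LocLipGradient f) :
    Continuous (gradient f) := by
  refine continuous_iff_continuousAt.2 fun x => ?_
  obtain ⟨C, hC, h⟩ := hf.2 _ (isCompact_closedBall x 1)
  have hl : LipschitzOnWith C.toNNReal (gradient f) (Metric.closedBall x 1) :=
    LipschitzOnWith.of_dist_le_mul fun y hy z hz => by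
      rw [dist_eq_norm, dist_eq_norm, Real.coe_toNNReal _ hC.le]; exact h y hy z hz
  exact hl.continuousOn.continuousAt (Metric.closedBall_mem_nhds x one_pos)

lemma metricProj_nonempty {d : ℕ} {X : Set (RSpace d)} (hXc : IsCompact X) (hne : X.Nonempty)
    (x : RSpace d) : (metricProj X x).Nonempty := by
  obtain ⟨p, hp, h⟩ := hXc.exists_infDist_eq_dist hne x
  exact ⟨p, hp, by rw [h, dist_eq_norm]⟩

lemma mem_closedNbhd_iff {d : ℕ} {X : Set (RSpace d)} (hne : X.Nonempty) {r : ℝ} (hr : 0 ≤ r)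
    {x : RSpace d} : x ∈ closedNbhd r X ↔ Metric.infDist x X ≤ r := by
  rw [closedNbhd, Metric.mem_cthickening_iff, Metric.infDist,
    ENNReal.le_ofReal_iff_toReal_le (Metric.infEDist_ne_top hne) hr]

lemma nonempty_of_mem_closedNbhd {d : ℕ} {X : Set (RSpace d)} {r : ℝ} {x : RSpace d}
    (hx : x ∈ closedNbhd r X) : X.Nonempty := by
  rw [Set.nonempty_iff_ne_empty]
  rintro rfl
  simp [closedNbhd] at hx

lemma measurableSet_closedNbhd {d : ℕ} (r : ℝ) (X : Set (RSpace d)) :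
    MeasurableSet (closedNbhd r X) :=
  Metric.isClosed_cthickening.measurableSet

/-- The gradient vanishes on `X`, so on `N_r(X)` it is at most `L` times the distance to `X`. -/
lemma norm_gradient_le_of_mem_metricProj {d : ℕ} {f : RSpace d → ℝ} {fstar : ℝ}
    {X : Set (RSpace d)} {r L : ℝ}
    (hmin : IsLeast (Set.range f) fstar) (hX : X ⊆ {y | f y = fstar})
    (hL : ∀ y ∈ closedNbhd r X, ∀ z ∈ closedNbhd r X,
      ‖gradient f y - gradient f z‖ ≤ L * ‖y - z‖)
    {x p : RSpace d} (hx : x ∈ closedNbhd r X) (hp : p ∈ metricProj X x) :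
    ‖gradient f x‖ ≤ L * ‖x - p‖ := by
  have h := hL x hx p (Metric.self_subset_cthickening X hp.1)
  rwa [gradient_eq_zero_of_isLeast hmin (hX hp.1), sub_zero] at h

/-- The squared norm of a sum of independent centered random vectors has no cross terms in
expectation. -/
lemma integral_norm_sum_sq_le {Ω E ι : Type*} [MeasurableSpace Ω] [NormedAddCommGroup E]
    [InnerProductSpace ℝ E] [MeasurableSpace E] [BorelSpace E] [CompleteSpace E]
    [SecondCountableTopology E] [Fintype ι]
    {P : Measure Ω} [IsProbabilityMeasure P] {Y : ι → Ω → E} (hY : ∀ i, MemLp (Y i) 2 P)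
    (h0 : ∀ i, ∫ ω, Y i ω ∂P = 0) (hind : Pairwise fun i j => IndepFun (Y i) (Y j) P) {σ : ℝ}
    (hσ : ∀ i, ∫ ω, ‖Y i ω‖ ^ 2 ∂P ≤ σ) :
    ∫ ω, ‖∑ i, Y i ω‖ ^ 2 ∂P ≤ Fintype.card ι * σ := by
  classical
  have hint : ∀ i j, Integrable (fun ω => inner ℝ (Y i ω) (Y j ω)) P := by
    intro i j
    refine (((hY i).integrable_norm_pow (by norm_num)).add
      ((hY j).integrable_norm_pow (by norm_num))).mono'
      ((hY i).aestronglyMeasurable.inner (hY j).aestronglyMeasurable)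
      (Filter.Eventually.of_forall fun ω => ?_)
    have h := norm_inner_le_norm (𝕜 := ℝ) (Y i ω) (Y j ω)
    rw [Pi.add_apply]
    nlinarith [sq_nonneg (‖Y i ω‖ - ‖Y j ω‖), sq_nonneg (‖Y i ω‖), sq_nonneg (‖Y j ω‖)]
  have hcross : ∀ i j, i ≠ j → ∫ ω, inner ℝ (Y i ω) (Y j ω) ∂P = 0 := by
    intro i j hij
    have h := (hind hij).integral_bilin ((hY i).integrable (by norm_num))
      ((hY j).integrable (by norm_num)) (innerSL ℝ)
    rw [h0, map_zero, zero_apply] at h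
    exact h
  calc ∫ ω, ‖∑ i, Y i ω‖ ^ 2 ∂P
      = ∫ ω, ∑ i, ∑ j, inner ℝ (Y i ω) (Y j ω) ∂P := by
        refine integral_congr_ae (Filter.Eventually.of_forall fun ω => ?_)
        simp only
        rw [← real_inner_self_eq_norm_sq, sum_inner]
        simp_rw [inner_sum]
    _ = ∑ i, ∑ j, ∫ ω, inner ℝ (Y i ω) (Y j ω) ∂P := by
        rw [integral_finsetSum _ fun i _ => integrable_finsetSum _ fun j _ => hint i j]
        exact Finset.sum_congr rfl fun i _ => integral_finsetSum _ fun j _ => hint i j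
    _ = ∑ i, ∫ ω, ‖Y i ω‖ ^ 2 ∂P := by
        refine Finset.sum_congr rfl fun i _ => ?_
        rw [Finset.sum_eq_single i (fun j _ hj => hcross i j hj.symm) (by simp)]
        simp_rw [real_inner_self_eq_norm_sq]
    _ ≤ ∑ _i : ι, σ := Finset.sum_le_sum fun i _ => hσ i
    _ = Fintype.card ι * σ := by simp

/-- One noisy gradient step `x ↦ x - a (g + η)` with centered noise `η`: the expected squared
distance to `X` after the step is compared with the distance to a fixed point `p` of `X`. -/
lemma lintegral_infDist_sq_step_le {Ω : Type*} {d : ℕ} [MeasurableSpace Ω] {P : Measure Ω}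
    [IsProbabilityMeasure P] {X : Set (RSpace d)} {η : Ω → RSpace d} (hη : MemLp η 2 P)
    (h0 : ∫ ω, η ω ∂P = 0) {v : ℝ} (hv : ∫ ω, ‖η ω‖ ^ 2 ∂P ≤ v) (a : ℝ) (x g : RSpace d)
    {p : RSpace d} (hp : p ∈ X) :
    ∫⁻ ω, ENNReal.ofReal (Metric.infDist (x - a • (g + η ω)) X ^ 2) ∂P ≤
      ENNReal.ofReal (‖x - p‖ ^ 2 - 2 * a * inner ℝ g (x - p) + a ^ 2 * ‖g‖ ^ 2 + a ^ 2 * v) := by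
  have hexp : ∀ ω, ‖x - a • (g + η ω) - p‖ ^ 2 =
      (‖x - p‖ ^ 2 - 2 * a * inner ℝ g (x - p) + a ^ 2 * ‖g‖ ^ 2) +
        (inner ℝ ((2 * a ^ 2) • g - (2 * a) • (x - p)) (η ω) + a ^ 2 * ‖η ω‖ ^ 2) := by
    intro ω
    have : x - a • (g + η ω) - p = (x - p) - a • (g + η ω) := by abel
    rw [this, norm_sub_sq_real, norm_smul, mul_pow, norm_add_sq_real, Real.norm_eq_abs, sq_abs]
    simp only [inner_smul_right, inner_add_right, inner_sub_left, inner_smul_left,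
      real_inner_comm g (x - p), inner_sub_left, conj_trivial, inner_sub_right]
    rw [real_inner_comm x g, real_inner_comm p g]
    ring
  have hηi : Integrable η P := hη.integrable (by norm_num)
  have hη2 : Integrable (fun ω => ‖η ω‖ ^ 2) P := hη.integrable_norm_pow (by norm_num)
  have hi1 := hηi.const_inner ((2 * a ^ 2) • g - (2 * a) • (x - p)) (𝕜 := ℝ)
  have hint : Integrable (fun ω => ‖x - a • (g + η ω) - p‖ ^ 2) P := by
    simp_rw [hexp]
    exact (integrable_const _).add (hi1.add (hη2.const_mul _))
  calc ∫⁻ ω, ENNReal.ofReal (Metric.infDist (x - a • (g + η ω)) X ^ 2) ∂P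
      ≤ ∫⁻ ω, ENNReal.ofReal (‖x - a • (g + η ω) - p‖ ^ 2) ∂P := by
        refine lintegral_mono fun ω => ENNReal.ofReal_le_ofReal ?_
        rw [← dist_eq_norm]
        exact pow_le_pow_left₀ Metric.infDist_nonneg (Metric.infDist_le_dist_of_mem hp) 2
    _ = ENNReal.ofReal (∫ ω, ‖x - a • (g + η ω) - p‖ ^ 2 ∂P) :=
        (ofReal_integral_eq_lintegral_ofReal hint
          (Filter.Eventually.of_forall fun ω => by positivity)).symm
    _ ≤ _ := by
        refine ENNReal.ofReal_le_ofReal ?_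
        simp_rw [hexp]
        rw [integral_add (integrable_const _) (by exact hi1.add (hη2.const_mul _)),
          integral_add hi1 (hη2.const_mul _), integral_const_mul, integral_inner hηi, h0]
        simp only [integral_const, probReal_univ, one_smul, inner_zero_right, zero_add]
        gcongr

lemma IndepFun.lintegral_comp_prodMk {Ω α β : Type*} [MeasurableSpace Ω] [MeasurableSpace α]
    [MeasurableSpace β] {P : Measure Ω} [IsProbabilityMeasure P] {Y : Ω → α} {Z : Ω → β}
    (hY : Measurable Y) (hZ : Measurable Z) (h : IndepFun Y Z P) {F : α × β → ENNReal}
    (hF : Measurable F) :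
    ∫⁻ ω, F (Y ω, Z ω) ∂P = ∫⁻ ω, ∫⁻ ω', F (Y ω, Z ω') ∂P ∂P := by
  have : IsProbabilityMeasure (P.map Z) := Measure.isProbabilityMeasure_map hZ.aemeasurable
  have hmap := (indepFun_iff_map_prod_eq_prod_map_map hY.aemeasurable hZ.aemeasurable).1 h
  rw [← lintegral_map (f := F) hF (hY.prodMk hZ), hmap, lintegral_prod _ hF.aemeasurable,
    lintegral_map hF.lintegral_prod_right' hY]
  refine lintegral_congr fun ω => ?_
  exact lintegral_map (hF.comp measurable_prodMk_left) hZ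

/-! ### Conditional expectation along the iteration -/

/-- The event that the iterates `x₁, …, x_n` all lie in `N_r(X)`. -/
def stayEvent {d : ℕ} {Ω : Type*} (X : Set (RSpace d)) (r : ℝ) (x : ℕ → Ω → RSpace d) (n : ℕ) :
    Set Ω :=
  {ω | ∀ m ∈ Finset.Icc 1 n, x m ω ∈ closedNbhd r X}

/-- The σ-algebra generated by the samples used before step `n`. As the samples are indexed by
`ℕ × Fin I` with the step number shifted by one, this is the family of all `p` with
`p.1 + 1 < n`. -/
@[reducible] def pastSigma {Ω S : Type*} [MeasurableSpace S] {I : ℕ} (s : ℕ → Fin I → Ω → S) (n : ℕ) :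
    MeasurableSpace Ω :=
  ⨆ p ∈ {p : ℕ × Fin I | p.1 + 1 < n},
    MeasurableSpace.comap (s (p.1 + 1) p.2) inferInstance

lemma pastSigma_mono {Ω S : Type*} [MeasurableSpace S] {I : ℕ} (s : ℕ → Fin I → Ω → S) {m n : ℕ}
    (h : m ≤ n) : pastSigma s m ≤ pastSigma s n :=
  biSup_mono fun _ hp => lt_of_lt_of_le hp h

lemma pastSigma_le {Ω S : Type*} [mΩ : MeasurableSpace Ω] [MeasurableSpace S] {I : ℕ}
    {s : ℕ → Fin I → Ω → S} (hs : ∀ n, 1 ≤ n → ∀ i, Measurable (s n i)) (n : ℕ) :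
    pastSigma s n ≤ mΩ :=
  iSup₂_le fun p _ => (hs (p.1 + 1) (by omega) p.2).comap_le

/-- The batch of step `n` is measurable with respect to any σ-algebra containing the one generated
by the samples of step `n`. -/
lemma measurable_batch_of_le {Ω S : Type*} [MeasurableSpace S] {I : ℕ}
    (s : ℕ → Fin I → Ω → S) {n : ℕ} (hn : 1 ≤ n) {T : Set (ℕ × Fin I)}
    (hT : ∀ i, (n - 1, i) ∈ T) :
    Measurable[⨆ p ∈ T, MeasurableSpace.comap (s (p.1 + 1) p.2) inferInstance]
      (fun ω i => s n i ω) := by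
  refine @measurable_pi_lambda _ _ _ (_) _ _ fun i => ?_
  have hle := le_iSup₂ (f := fun (p : ℕ × Fin I) (_ : p ∈ T) =>
    MeasurableSpace.comap (s (p.1 + 1) p.2) inferInstance) (n - 1, i) (hT i)
  refine (comap_measurable (s n i)).mono (le_trans (le_of_eq ?_) hle) le_rfl
  simp only [show n - 1 + 1 = n by omega]

/-- A random variable measurable with respect to the past is independent of the fresh batch. -/
lemma indepFun_of_measurable_pastSigma {Ω S α : Type*} [mΩ : MeasurableSpace Ω]
    [MeasurableSpace S] [MeasurableSpace α] {P : Measure Ω} {I : ℕ} {s : ℕ → Fin I → Ω → S}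
    (hs : ∀ n, 1 ≤ n → ∀ i, Measurable (s n i))
    (hind : iIndepFun (fun p : ℕ × Fin I => s (p.1 + 1) p.2) P) {n : ℕ} (hn : 1 ≤ n)
    {Y : Ω → α} (hY : Measurable[pastSigma s n] Y) :
    IndepFun Y (fun ω i => s n i ω) P := by
  have hdisj : Disjoint {p : ℕ × Fin I | p.1 + 1 < n} {p : ℕ × Fin I | p.1 + 1 = n} :=
    Set.disjoint_left.2 fun p hp hq => absurd hq (ne_of_lt hp)
  have h := indep_iSup_of_disjoint
    (fun p : ℕ × Fin I => (hs (p.1 + 1) (by omega) p.2).comap_le)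
    ((iIndepFun_iff_iIndep _ _ _).1 hind) hdisj
  rw [IndepFun_iff_Indep]
  refine indep_of_indep_of_le_left (indep_of_indep_of_le_right h ?_) hY.comap_le
  exact Measurable.comap_le (measurable_batch_of_le s hn fun _ => Nat.sub_add_cancel hn)

/-- The map performing one SGD step from `y` with the batch `b`. -/
noncomputable def sgdStep {d : ℕ} {S : Type*} (f : RSpace d → ℝ) (ξ : RSpace d → S → RSpace d) {I : ℕ}
    (c : ℝ) (y : RSpace d) (b : Fin I → S) : RSpace d :=
  y - c • (gradient f y + (I : ℝ)⁻¹ • ∑ i, ξ y (b i))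

lemma measurable_sgdStep {d : ℕ} {S : Type*} [MeasurableSpace S] {f : RSpace d → ℝ}
    (hf : LocLipGradient f) {ξ : RSpace d → S → RSpace d}
    (hξ : Measurable (Function.uncurry ξ)) {I : ℕ} (c : ℝ) :
    Measurable fun q : RSpace d × (Fin I → S) => sgdStep f ξ c q.1 q.2 := by
  have hg : Measurable fun q : RSpace d × (Fin I → S) => gradient f q.1 :=
    hf.continuous_gradient.measurable.comp measurable_fst
  have hn : ∀ i : Fin I, Measurable fun q : RSpace d × (Fin I → S) => ξ q.1 (q.2 i) := fun i =>
    hξ.comp (measurable_fst.prodMk ((measurable_pi_apply i).comp measurable_snd))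
  have hsum : Measurable fun q : RSpace d × (Fin I → S) => ∑ i, ξ q.1 (q.2 i) :=
    Finset.measurable_fun_sum _ fun i _ => hn i
  unfold sgdStep
  fun_prop

lemma measurable_iterate_pastSigma {d : ℕ} {Ω S : Type*} [MeasurableSpace S]
    {f : RSpace d → ℝ} (hf : LocLipGradient f) {ξ : RSpace d → S → RSpace d}
    (hξ : Measurable (Function.uncurry ξ)) {I : ℕ} {a : ℕ → ℝ} {x₁ : RSpace d}
    {x : ℕ → Ω → RSpace d} {s : ℕ → Fin I → Ω → S} (h1 : ∀ ω, x 1 ω = x₁)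
    (hx : ∀ n, 1 ≤ n → ∀ ω, x (n + 1) ω = sgdStep f ξ (a n) (x n ω) fun i => s n i ω)
    {n : ℕ} (hn : 1 ≤ n) : Measurable[pastSigma s n] (x n) := by
  induction n, hn using Nat.le_induction with
  | base => rw [show x 1 = fun _ => x₁ from funext h1]; exact measurable_const
  | succ n hn ih =>
    rw [show x (n + 1) = fun ω => sgdStep f ξ (a n) (x n ω) fun i => s n i ω from
      funext (hx n hn)]
    have hb : Measurable[pastSigma s (n + 1)] fun ω i => s n i ω :=
      measurable_batch_of_le s hn fun _ => by change n - 1 + 1 < n + 1; omega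
    exact (measurable_sgdStep hf hξ (a n)).comp
      ((ih.mono (pastSigma_mono s n.le_succ) le_rfl).prodMk hb)

lemma measurableSet_stayEvent_pastSigma {d : ℕ} {Ω S : Type*} [MeasurableSpace S] {I : ℕ}
    {X : Set (RSpace d)} {r : ℝ} {x : ℕ → Ω → RSpace d} {s : ℕ → Fin I → Ω → S}
    (hx : ∀ n, 1 ≤ n → Measurable[pastSigma s n] (x n)) (n : ℕ) :
    MeasurableSet[pastSigma s n] (stayEvent X r x n) := by
  have : stayEvent X r x n = ⋂ m ∈ Finset.Icc 1 n, x m ⁻¹' closedNbhd r X := by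
    ext ω; simp [stayEvent]
  rw [this]
  refine Finset.measurableSet_biInter _ fun m hm => ?_
  rw [Finset.mem_Icc] at hm
  exact pastSigma_mono s hm.2 _ (hx m hm.1 (measurableSet_closedNbhd r X))

/-- The mean of a batch of `I` independent samples of the noise has second moment at most
`σ / I`. -/
lemma batch_noise_moments {d : ℕ} {Ω S : Type*} [MeasurableSpace Ω] [MeasurableSpace S]
    {P : Measure Ω} [IsProbabilityMeasure P] {ν : Measure S} {ξ : RSpace d → S → RSpace d}
    (hξ : NoiseAssumption ν ξ) {I : ℕ} (hI : 1 ≤ I) {b : Fin I → Ω → S}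
    (hb : ∀ i, Measurable (b i) ∧ P.map (b i) = ν)
    (hind : Pairwise fun i j => IndepFun (b i) (b j) P) {y : RSpace d} {σ : ℝ}
    (hσ : ∫ s, ‖ξ y s‖ ^ 2 ∂ν ≤ σ) :
    MemLp (fun ω => (I : ℝ)⁻¹ • ∑ i, ξ y (b i ω)) 2 P ∧
      ∫ ω, (I : ℝ)⁻¹ • ∑ i, ξ y (b i ω) ∂P = 0 ∧
      ∫ ω, ‖(I : ℝ)⁻¹ • ∑ i, ξ y (b i ω)‖ ^ 2 ∂P ≤ σ / I := by
  have hm : Measurable (ξ y) := hξ.measurable.comp measurable_prodMk_left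
  have hmap : ∀ i, Measure.map (b i) P = ν := fun i => (hb i).2
  have hL : ∀ i, MemLp (fun ω => ξ y (b i ω)) 2 P := fun i => by
    have := hξ.memLp y
    rw [← hmap i] at this
    exact this.comp_of_map (hb i).1.aemeasurable
  have h0 : ∀ i, ∫ ω, ξ y (b i ω) ∂P = 0 := fun i => by
    rw [← hξ.centered y, ← hmap i, integral_map (hb i).1.aemeasurable hm.aestronglyMeasurable]
  have h2 : ∀ i, ∫ ω, ‖ξ y (b i ω)‖ ^ 2 ∂P ≤ σ := fun i => by
    rw [← hmap i, integral_map (hb i).1.aemeasurable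
      (hm.norm.pow_const 2).aestronglyMeasurable] at hσ
    exact hσ
  have hsum := integral_norm_sum_sq_le hL h0 (fun i j hij => (hind hij).comp hm hm) h2
  have hLsum : MemLp (fun ω => ∑ i, ξ y (b i ω)) 2 P := memLp_finsetSum _ fun i _ => hL i
  refine ⟨hLsum.const_smul (I : ℝ)⁻¹, ?_, ?_⟩
  · rw [integral_smul, integral_finsetSum _ fun i _ => (hL i).integrable (by norm_num)]
    simp [h0]
  · have hI' : (0 : ℝ) < I := by exact_mod_cast hI
    simp_rw [norm_smul, mul_pow]
    rw [integral_const_mul]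
    simp only [Fintype.card_fin] at hsum
    calc _ ≤ ‖(I : ℝ)⁻¹‖ ^ 2 * (I * σ) := by gcongr
      _ = σ / I := by
        rw [Real.norm_of_nonneg (by positivity)]; field_simp

/-- Conditional form of one step. The function `ψ n` is the conditional expectation of
`dist(x_{n+1}, X)²` given `x_n`; its bound holds for every nearest point `p` separately, so that
no measurable choice of nearest points is needed. -/
lemma SGDSetting.exists_conditional_step {d : ℕ} {Ω S : Type*} [MeasurableSpace Ω]
    [MeasurableSpace S] {P : Measure Ω} [IsProbabilityMeasure P] {ν : Measure S}
    {f : RSpace d → ℝ} {fstar : ℝ} {X : Set (RSpace d)} {r L σ : ℝ}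
    {ξ : RSpace d → S → RSpace d} {I : ℕ} {a : ℕ → ℝ} {x₁ : RSpace d} {x : ℕ → Ω → RSpace d}
    (hf : LocLipGradient f) (hmin : IsLeast (Set.range f) fstar) (hXc : IsCompact X)
    (hX : X ⊆ {y | f y = fstar}) (hr : 0 ≤ r) (hs : SGDSetting P ν f X r L σ ξ I a x₁ x) :
    (∀ n, 1 ≤ n → Measurable (x n)) ∧ (∀ n, MeasurableSet (stayEvent X r x n)) ∧
      ∃ ψ : ℕ → RSpace d → ℝ, (∀ n, Measurable (ψ n)) ∧ (∀ n y, 0 ≤ ψ n y) ∧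
        (∀ n, 1 ≤ n → ∀ y ∈ closedNbhd r X, ∀ p ∈ metricProj X y,
          ψ n y ≤ (1 + L ^ 2 * a n ^ 2) * Metric.infDist y X ^ 2 + a n ^ 2 * (σ / I)
            - 2 * a n * inner ℝ (gradient f y) (y - p)) ∧
        ∀ n, 1 ≤ n →
          IntegrableOn (fun ω => Metric.infDist (x (n + 1) ω) X ^ 2) (stayEvent X r x n) P ∧
          IntegrableOn (fun ω => ψ n (x n ω)) (stayEvent X r x n) P ∧
          ∫ ω in stayEvent X r x n, Metric.infDist (x (n + 1) ω) X ^ 2 ∂P =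
            ∫ ω in stayEvent X r x n, ψ n (x n ω) ∂P := by
  obtain ⟨s, hsm, hind, h1, hstep⟩ := hs.sgd
  have hsm' : ∀ n, 1 ≤ n → ∀ i, Measurable (s n i) := fun n hn i => (hsm n hn i).1
  have hξ := hs.noise.measurable
  have hxp : ∀ n, 1 ≤ n → Measurable[pastSigma s n] (x n) := fun n hn =>
    measurable_iterate_pastSigma hf hξ h1 hstep hn
  have hxm : ∀ n, 1 ≤ n → Measurable (x n) := fun n hn =>
    (hxp n hn).mono (pastSigma_le hsm' n) le_rfl
  have hAp : ∀ n, MeasurableSet[pastSigma s n] (stayEvent X r x n) :=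
    measurableSet_stayEvent_pastSigma hxp
  have hAm : ∀ n, MeasurableSet (stayEvent X r x n) := fun n => pastSigma_le hsm' n _ (hAp n)
  refine ⟨hxm, hAm, ?_⟩
  have hne : X.Nonempty := nonempty_of_mem_closedNbhd hs.init
  -- the integrand of the conditional expectation, as a function of the iterate and of the batch
  let D : ℕ → RSpace d × (Fin I → S) → ENNReal := fun n q =>
    ENNReal.ofReal (Metric.infDist (sgdStep f ξ (a n) q.1 q.2) X ^ 2)
  have hD : ∀ n, Measurable (D n) := fun n =>
    (((Metric.continuous_infDist_pt X).measurable.comp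
      (measurable_sgdStep hf hξ (a n))).pow_const 2).ennreal_ofReal
  let Ψ : ℕ → RSpace d → ENNReal := fun n y => ∫⁻ b, D n (y, b) ∂(P.map fun ω i => s n i ω)
  have hΨ : ∀ n, Measurable (Ψ n) := fun n => (hD n).lintegral_prod_right'
  have hbm : ∀ n, 1 ≤ n → Measurable fun ω i => s n i ω := fun n hn =>
    measurable_pi_iff.2 (hsm' n hn)
  have hΨeq : ∀ n, 1 ≤ n → ∀ y, Ψ n y = ∫⁻ ω, D n (y, fun i => s n i ω) ∂P := fun n hn y =>
    lintegral_map ((hD n).comp measurable_prodMk_left) (hbm n hn)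
  have hbound : ∀ n, 1 ≤ n → ∀ y ∈ closedNbhd r X, ∀ p ∈ metricProj X y,
      Ψ n y ≤ ENNReal.ofReal ((1 + L ^ 2 * a n ^ 2) * Metric.infDist y X ^ 2 + a n ^ 2 * (σ / I)
        - 2 * a n * inner ℝ (gradient f y) (y - p)) := by
    intro n hn y hy p hp
    have hpair : Pairwise fun i j => IndepFun (s n i) (s n j) P := by
      intro i j hij
      have h := hind.indepFun (i := (n - 1, i)) (j := (n - 1, j)) (by simpa using hij)
      simpa only [show n - 1 + 1 = n by omega] using h
    obtain ⟨hL2, h0, hv⟩ := batch_noise_moments hs.noise hs.batch_pos (hsm n hn) hpair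
      (hs.variance y hy)
    rw [hΨeq n hn]
    refine (lintegral_infDist_sq_step_le hL2 h0 hv (a n) y (gradient f y) hp.1).trans
      (ENNReal.ofReal_le_ofReal ?_)
    have hg := norm_gradient_le_of_mem_metricProj hmin hX hs.lipschitz hy hp
    rw [hp.2] at hg ⊢
    have : a n ^ 2 * ‖gradient f y‖ ^ 2 ≤ a n ^ 2 * (L * Metric.infDist y X) ^ 2 := by gcongr
    linarith
  have hΨint : ∀ n, 1 ≤ n → ∫⁻ ω in stayEvent X r x n,
      ENNReal.ofReal (Metric.infDist (x (n + 1) ω) X ^ 2) ∂P =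
      ∫⁻ ω in stayEvent X r x n, Ψ n (x n ω) ∂P := by
    intro n hn
    -- the indicator of the event is part of the past
    let χ : Ω → ENNReal := (stayEvent X r x n).indicator fun _ => 1
    have hχ : Measurable[pastSigma s n] χ :=
      Measurable.indicator (m := pastSigma s n) (@measurable_const _ _ _ (pastSigma s n) _) (hAp n)
    have hχm : Measurable χ := hχ.mono (pastSigma_le hsm' n) le_rfl
    have h := IndepFun.lintegral_comp_prodMk ((hxm n hn).prodMk hχm) (hbm n hn)
      (indepFun_of_measurable_pastSigma hsm' hind hn ((hxp n hn).prodMk hχ))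
      (F := fun q => q.1.2 * D n (q.1.1, q.2))
      ((measurable_snd.comp measurable_fst).mul
        ((hD n).comp ((measurable_fst.comp measurable_fst).prodMk measurable_snd)))
    rw [← lintegral_indicator (hAm n), ← lintegral_indicator (hAm n)]
    have hl : ∀ ω, (stayEvent X r x n).indicator
        (fun ω => ENNReal.ofReal (Metric.infDist (x (n + 1) ω) X ^ 2)) ω =
        χ ω * D n (x n ω, fun i => s n i ω) := by
      intro ω
      by_cases hω : ω ∈ stayEvent X r x n
      · simp only [χ, D, Set.indicator_of_mem hω, one_mul]
        rw [hstep n hn ω]; rfl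
      · simp [χ, Set.indicator_of_notMem hω]
    have hr : ∀ ω, (stayEvent X r x n).indicator (fun ω => Ψ n (x n ω)) ω =
        ∫⁻ ω', χ ω * D n (x n ω, fun i => s n i ω') ∂P := by
      intro ω
      rw [lintegral_const_mul _ (by exact (hD n).comp (measurable_prodMk_left.comp (hbm n hn))),
        ← hΨeq n hn]
      by_cases hω : ω ∈ stayEvent X r x n
      · simp only [χ, Set.indicator_of_mem hω, one_mul]
      · simp [χ, Set.indicator_of_notMem hω]
    simp_rw [hl, hr]
    exact h
  have hmem : ∀ n, 1 ≤ n → ∀ ω ∈ stayEvent X r x n, x n ω ∈ closedNbhd r X := fun n hn ω hω =>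
    hω n (Finset.mem_Icc.2 ⟨hn, le_rfl⟩)
  have hfin : ∀ n, 1 ≤ n → ∀ y ∈ closedNbhd r X, Ψ n y < ⊤ := by
    intro n hn y hy
    obtain ⟨p, hp⟩ := metricProj_nonempty hXc hne y
    exact (hbound n hn y hy p hp).trans_lt ENNReal.ofReal_lt_top
  -- a uniform bound on `N_r(X)`, by Cauchy–Schwarz for the inner product term
  have hunif : ∀ n, 1 ≤ n → ∀ y ∈ closedNbhd r X, Ψ n y ≤
      ENNReal.ofReal ((1 + L ^ 2 * a n ^ 2) * r ^ 2 + a n ^ 2 * (σ / I)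
        + 2 * a n * (L * r * r)) := by
    intro n hn y hy
    obtain ⟨p, hp⟩ := metricProj_nonempty hXc hne y
    refine (hbound n hn y hy p hp).trans (ENNReal.ofReal_le_ofReal ?_)
    have hyr := (mem_closedNbhd_iff hne hr).1 hy
    have hg := norm_gradient_le_of_mem_metricProj hmin hX hs.lipschitz hy hp
    have hc := (abs_le.1 (abs_real_inner_le_norm (gradient f y) (y - p))).1
    rw [hp.2] at hg hc
    have hi0 : 0 ≤ Metric.infDist y X := Metric.infDist_nonneg
    have han := hs.steps.pos n hn
    have hLp := hs.L_pos
    have h3 : ‖gradient f y‖ * Metric.infDist y X ≤ L * r * r := by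
      have : ‖gradient f y‖ ≤ L * r := hg.trans (by gcongr)
      gcongr
    have h4 : 2 * a n * (-(L * r * r)) ≤ 2 * a n * inner ℝ (gradient f y) (y - p) := by
      gcongr; linarith
    have h5 : (1 + L ^ 2 * a n ^ 2) * Metric.infDist y X ^ 2 ≤ (1 + L ^ 2 * a n ^ 2) * r ^ 2 := by
      gcongr
    linarith
  refine ⟨fun n y => (Ψ n y).toReal, fun n => (hΨ n).ennreal_toReal,
    fun n y => ENNReal.toReal_nonneg, ?_, fun n hn => ?_⟩
  · intro n hn y hy p hp
    have hb := hbound n hn y hy p hp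
    refine ENNReal.toReal_le_of_le_ofReal ?_ hb
    have hg := norm_gradient_le_of_mem_metricProj hmin hX hs.lipschitz hy hp
    have hc := (le_abs_self _).trans (abs_real_inner_le_norm (gradient f y) (y - p))
    rw [hp.2] at hg hc
    have hi0 : 0 ≤ Metric.infDist y X := Metric.infDist_nonneg
    have han := hs.steps.pos n hn
    have hLp := hs.L_pos
    have hσ := hs.σ_pos
    have h3 : inner ℝ (gradient f y) (y - p) ≤ L * Metric.infDist y X * Metric.infDist y X :=
      hc.trans (by gcongr)
    have h4 : 2 * a n * inner ℝ (gradient f y) (y - p) ≤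
        2 * a n * (L * Metric.infDist y X * Metric.infDist y X) := by gcongr
    have h5 : 0 ≤ a n ^ 2 * (σ / I) := by positivity
    nlinarith [mul_nonneg (sq_nonneg (1 - L * a n)) (sq_nonneg (Metric.infDist y X))]
  · have hmeasD : Measurable fun ω => Metric.infDist (x (n + 1) ω) X ^ 2 :=
      ((Metric.continuous_infDist_pt X).measurable.comp (hxm (n + 1) (by omega))).pow_const 2
    have hae : ∀ᵐ ω ∂(P.restrict (stayEvent X r x n)), Ψ n (x n ω) < ⊤ :=
      (ae_restrict_iff' (hAm n)).2
        (Filter.Eventually.of_forall fun ω hω => hfin n hn _ (hmem n hn ω hω))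
    have hΨfin : ∫⁻ ω in stayEvent X r x n, Ψ n (x n ω) ∂P ≠ ⊤ := by
      refine ne_of_lt (lt_of_le_of_lt (setLIntegral_mono' (hAm n) fun ω hω =>
        hunif n hn _ (hmem n hn ω hω)) ?_)
      rw [setLIntegral_const]
      exact ENNReal.mul_lt_top ENNReal.ofReal_lt_top (measure_lt_top _ _)
    refine ⟨⟨hmeasD.aestronglyMeasurable, ?_⟩, integrable_toReal_of_lintegral_ne_top
      ((hΨ n).comp (hxm n hn)).aemeasurable hΨfin, ?_⟩
    · rw [hasFiniteIntegral_iff_ofReal (Filter.Eventually.of_forall fun ω => by positivity),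
        hΨint n hn]
      exact hΨfin.lt_top
    · rw [integral_toReal (by exact ((hΨ n).comp (hxm n hn)).aemeasurable) hae, ← hΨint n hn,
        integral_eq_lintegral_of_nonneg_ae (Filter.Eventually.of_forall fun ω => by positivity)
        hmeasD.aestronglyMeasurable]

/-! ### Stopped Lyapunov inequality and the general bound -/

lemma stayEvent_antitone {d : ℕ} {Ω : Type*} (X : Set (RSpace d)) (r : ℝ)
    (x : ℕ → Ω → RSpace d) : Antitone (stayEvent X r x) := fun _ _ hmn _ hω k hk =>
  hω k (Finset.Icc_subset_Icc_right hmn hk)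

lemma mem_closedNbhd_of_mem_stayEvent {d : ℕ} {Ω : Type*} {X : Set (RSpace d)} {r : ℝ}
    {x : ℕ → Ω → RSpace d} {n : ℕ} (hn : 1 ≤ n) {ω : Ω} (hω : ω ∈ stayEvent X r x n) :
    x n ω ∈ closedNbhd r X :=
  hω n (Finset.mem_Icc.2 ⟨hn, le_rfl⟩)

lemma one_le_bSeq (L : ℝ) (a : ℕ → ℝ) (n : ℕ) : 1 ≤ bSeq L a n :=
  Finset.prod_induction _ (1 ≤ ·) (fun _ _ => one_le_mul_of_one_le_of_one_le) le_rfl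
    fun j _ => by nlinarith [sq_nonneg (L * a j)]

lemma bSeq_pos (L : ℝ) (a : ℕ → ℝ) (n : ℕ) : 0 < bSeq L a n :=
  one_pos.trans_le (one_le_bSeq L a n)

lemma bSeq_succ (L : ℝ) (a : ℕ → ℝ) {n : ℕ} (hn : 1 ≤ n) :
    bSeq L a (n + 1) = bSeq L a n * (1 + L ^ 2 * a n ^ 2) :=
  Finset.prod_Ico_succ_top hn _

lemma bSeq_le_exp {L : ℝ} {a : ℕ → ℝ} (ha : Summable fun n => a (n + 1) ^ 2) (n : ℕ) :
    bSeq L a n ≤ Real.exp (L ^ 2 * ∑' k, a (k + 1) ^ 2) := by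
  calc bSeq L a n ≤ ∏ j ∈ Finset.Ico 1 n, Real.exp (L ^ 2 * a j ^ 2) :=
        Finset.prod_le_prod (fun j _ => by positivity) fun j _ => by
          rw [add_comm]; exact Real.add_one_le_exp _
    _ = Real.exp (L ^ 2 * ∑ j ∈ Finset.Ico 1 n, a j ^ 2) := by
        rw [← Real.exp_sum, Finset.mul_sum]
    _ ≤ _ := by
        gcongr
        rw [Finset.sum_Ico_eq_sum_range]
        simp_rw [add_comm 1]
        exact ha.sum_le_tsum _ fun k _ => sq_nonneg _

lemma lyapunovInit_succ {d : ℕ} (X : Set (RSpace d)) (L σ : ℝ) (I : ℕ) (a : ℕ → ℝ)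
    (x₁ : RSpace d) {n : ℕ} (hn : 1 ≤ n) :
    lyapunovInit X L σ I a x₁ (n + 1) =
      lyapunovInit X L σ I a x₁ n + σ / I * (a n ^ 2 / bSeq L a (n + 1)) := by
  rw [lyapunovInit, lyapunovInit, Finset.sum_Ico_succ_top hn]
  ring

lemma lyapunovInit_nonneg {d : ℕ} (X : Set (RSpace d)) (L : ℝ) {σ : ℝ} (hσ : 0 ≤ σ) (I : ℕ)
    (a : ℕ → ℝ) (x₁ : RSpace d) (n : ℕ) : 0 ≤ lyapunovInit X L σ I a x₁ n := by
  have : ∀ k, 0 ≤ a k ^ 2 / bSeq L a (k + 1) := fun k =>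
    div_nonneg (sq_nonneg _) (bSeq_pos L a _).le
  have := Finset.sum_nonneg fun k (_ : k ∈ Finset.Ico 1 n) => this k
  unfold lyapunovInit
  positivity

lemma lyapunovInit_le {d : ℕ} (X : Set (RSpace d)) (L : ℝ) {σ : ℝ} (hσ : 0 ≤ σ) (I : ℕ)
    {a : ℕ → ℝ} (ha : Summable fun n => a (n + 1) ^ 2) (x₁ : RSpace d) (n : ℕ) :
    lyapunovInit X L σ I a x₁ n ≤
      Metric.infDist x₁ X ^ 2 + σ / I * ∑' k, a (k + 1) ^ 2 := by
  unfold lyapunovInit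
  gcongr
  calc _ ≤ ∑ j ∈ Finset.Ico 1 n, a j ^ 2 := Finset.sum_le_sum fun j _ =>
        div_le_self (sq_nonneg _) (one_le_bSeq L a _)
    _ ≤ _ := by
        rw [Finset.sum_Ico_eq_sum_range]
        simp_rw [add_comm 1]
        exact ha.sum_le_tsum _ fun k _ => sq_nonneg _

/-- The drift `q n` is the expected decrease of `dist(·, X)²` at step `n`, corrected for the
second-order terms; on the event that the iterates have not left `N_r(X)` it dominates
`2 a_n ⟨∇f(x_n), x_n - p⟩` for every nearest point `p`. -/
lemma SGDSetting.exists_drift {d : ℕ} {Ω S : Type*} [MeasurableSpace Ω]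
    [MeasurableSpace S] {P : Measure Ω} [IsProbabilityMeasure P] {ν : Measure S}
    {f : RSpace d → ℝ} {fstar : ℝ} {X : Set (RSpace d)} {r L σ : ℝ}
    {ξ : RSpace d → S → RSpace d} {I : ℕ} {a : ℕ → ℝ} {x₁ : RSpace d} {x : ℕ → Ω → RSpace d}
    (hf : LocLipGradient f) (hmin : IsLeast (Set.range f) fstar) (hXc : IsCompact X)
    (hX : X ⊆ {y | f y = fstar}) (hr : 0 ≤ r) (hs : SGDSetting P ν f X r L σ ξ I a x₁ x) :
    (∀ n, MeasurableSet (stayEvent X r x n)) ∧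
      (∀ n, 1 ≤ n → Measurable fun ω => Metric.infDist (x n ω) X ^ 2) ∧
      (∀ n, 1 ≤ n →
        IntegrableOn (fun ω => Metric.infDist (x n ω) X ^ 2) (stayEvent X r x n) P) ∧
      ∃ q : ℕ → Ω → ℝ, ∀ n, 1 ≤ n → Measurable (q n) ∧
        IntegrableOn (q n) (stayEvent X r x n) P ∧
        (∀ ω ∈ stayEvent X r x n, ∀ p ∈ metricProj X (x n ω),
          2 * a n * inner ℝ (gradient f (x n ω)) (x n ω - p) ≤ q n ω) ∧
        IntegrableOn (fun ω => Metric.infDist (x (n + 1) ω) X ^ 2) (stayEvent X r x n) P ∧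
        ∫ ω in stayEvent X r x n, Metric.infDist (x (n + 1) ω) X ^ 2 ∂P +
            ∫ ω in stayEvent X r x n, q n ω ∂P ≤
          (1 + L ^ 2 * a n ^ 2) * ∫ ω in stayEvent X r x n, Metric.infDist (x n ω) X ^ 2 ∂P
            + a n ^ 2 * (σ / I) := by
  obtain ⟨hxm, hAm, ψ, hψm, hψ0, hψb, hψi⟩ := hs.exists_conditional_step hf hmin hXc hX hr
  have hne : X.Nonempty := nonempty_of_mem_closedNbhd hs.init
  have hDm : ∀ n, 1 ≤ n → Measurable fun ω => Metric.infDist (x n ω) X ^ 2 := fun n hn =>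
    ((Metric.continuous_infDist_pt X).measurable.comp (hxm n hn)).pow_const 2
  have hDi : ∀ n, 1 ≤ n →
      IntegrableOn (fun ω => Metric.infDist (x n ω) X ^ 2) (stayEvent X r x n) P := by
    intro n hn
    refine Measure.integrableOn_of_bounded (M := r ^ 2) (measure_ne_top _ _)
      (hDm n hn).aestronglyMeasurable ((ae_restrict_iff' (hAm n)).2
        (Filter.Eventually.of_forall fun ω hω => ?_))
    rw [Real.norm_of_nonneg (sq_nonneg _)]
    exact pow_le_pow_left₀ Metric.infDist_nonneg
      ((mem_closedNbhd_iff hne hr).1 (mem_closedNbhd_of_mem_stayEvent hn hω)) 2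
  refine ⟨hAm, hDm, hDi, fun n ω => (1 + L ^ 2 * a n ^ 2) * Metric.infDist (x n ω) X ^ 2
    + a n ^ 2 * (σ / I) - ψ n (x n ω), fun n hn => ?_⟩
  obtain ⟨hi1, hi2, heq⟩ := hψi n hn
  have hc : IntegrableOn (fun _ : Ω => a n ^ 2 * (σ / I)) (stayEvent X r x n) P :=
    integrableOn_const (measure_ne_top _ _)
  have hsum : IntegrableOn (fun ω => (1 + L ^ 2 * a n ^ 2) * Metric.infDist (x n ω) X ^ 2
      + a n ^ 2 * (σ / I)) (stayEvent X r x n) P := ((hDi n hn).const_mul _).add hc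
  refine ⟨(((hDm n hn).const_mul _).add_const _).sub ((hψm n).comp (hxm n hn)),
    hsum.sub hi2, fun ω hω p hp => ?_, hi1, ?_⟩
  · linarith [hψb n hn _ (mem_closedNbhd_of_mem_stayEvent hn hω) p hp]
  · rw [integral_sub hsum hi2, integral_add ((hDi n hn).const_mul _) hc, integral_const_mul,
      heq, setIntegral_const, smul_eq_mul]
    have h1 : P.real (stayEvent X r x n) ≤ 1 := measureReal_le_one
    have h2 : 0 ≤ a n ^ 2 * (σ / I) := by have := hs.σ_pos; positivity
    nlinarith [mul_le_mul_of_nonneg_right h1 h2]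

/-- The Lyapunov inequality of the process stopped at its exit from `N_r(X)`. Leaving `N_r(X)`
at step `n + 1` costs at least `r²` of `dist(x_{n+1}, X)²`, which bounds the exit probability. -/
lemma SGDSetting.lyapunov_inequality {d : ℕ} {Ω S : Type*} [MeasurableSpace Ω]
    [MeasurableSpace S] {P : Measure Ω} [IsProbabilityMeasure P] {ν : Measure S}
    {f : RSpace d → ℝ} {X : Set (RSpace d)} {r L σ : ℝ}
    {ξ : RSpace d → S → RSpace d} {I : ℕ} {a : ℕ → ℝ} {x₁ : RSpace d} {x : ℕ → Ω → RSpace d}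
    (hr : 0 ≤ r) (hs : SGDSetting P ν f X r L σ ξ I a x₁ x)
    (hAm : ∀ n, MeasurableSet (stayEvent X r x n)) {q : ℕ → Ω → ℝ}
    (hq : ∀ n, 1 ≤ n →
        IntegrableOn (fun ω => Metric.infDist (x (n + 1) ω) X ^ 2) (stayEvent X r x n) P ∧
        ∫ ω in stayEvent X r x n, Metric.infDist (x (n + 1) ω) X ^ 2 ∂P +
            ∫ ω in stayEvent X r x n, q n ω ∂P ≤
          (1 + L ^ 2 * a n ^ 2) * ∫ ω in stayEvent X r x n, Metric.infDist (x n ω) X ^ 2 ∂P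
            + a n ^ 2 * (σ / I)) {N : ℕ} (hN : 1 ≤ N) :
    r ^ 2 / bSeq L a N * P.real (stayEvent X r x N)ᶜ +
        ∑ n ∈ Finset.Ico 1 N, (∫ ω in stayEvent X r x n, q n ω ∂P) / bSeq L a (n + 1) +
        (∫ ω in stayEvent X r x N, Metric.infDist (x N ω) X ^ 2 ∂P) / bSeq L a N ≤
      lyapunovInit X L σ I a x₁ N := by
  have hne : X.Nonempty := nonempty_of_mem_closedNbhd hs.init
  obtain ⟨-, -, -, h1, -⟩ := hs.sgd
  induction N, hN using Nat.le_induction with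
  | base =>
    have hA : stayEvent X r x 1 = Set.univ := by
      ext ω; simpa [stayEvent, h1] using hs.init
    simp [hA, h1, lyapunovInit, bSeq]
  | succ n hn ih =>
    obtain ⟨hi, hle⟩ := hq n hn
    set A := stayEvent X r x n
    set A' := stayEvent X r x (n + 1)
    have hsub : A' ⊆ A := stayEvent_antitone X r x n.le_succ
    -- split the integral over `A` according to whether the step leaves `N_r(X)`
    have hsplit : ∫ ω in A, Metric.infDist (x (n + 1) ω) X ^ 2 ∂P =
        ∫ ω in A', Metric.infDist (x (n + 1) ω) X ^ 2 ∂P +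
          ∫ ω in A \ A', Metric.infDist (x (n + 1) ω) X ^ 2 ∂P := by
      rw [← setIntegral_union Set.disjoint_sdiff_right ((hAm n).diff (hAm _))
        (hi.mono_set hsub) (hi.mono_set Set.sdiff_subset), Set.union_sdiff_cancel hsub]
    have hexit : r ^ 2 * P.real (A \ A') ≤
        ∫ ω in A \ A', Metric.infDist (x (n + 1) ω) X ^ 2 ∂P := by
      refine setIntegral_ge_of_const_le_real ((hAm n).diff (hAm _)) (measure_ne_top _ _) ?_
        (hi.mono_set Set.sdiff_subset)
      rintro ω ⟨hω, hω'⟩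
      refine pow_le_pow_left₀ hr (not_lt.1 fun hlt => hω' fun m hm => ?_) 2
      rw [Finset.mem_Icc] at hm
      rcases Nat.lt_or_ge n m with h | h
      · obtain rfl : m = n + 1 := by omega
        exact (mem_closedNbhd_iff hne hr).2 hlt.le
      · exact hω m (Finset.mem_Icc.2 ⟨hm.1, h⟩)
    have hcompl : P.real A'ᶜ = P.real Aᶜ + P.real (A \ A') := by
      rw [← measureReal_union (Set.disjoint_left.2 fun ω (h : ω ∈ Aᶜ) h' => h h'.1)
        ((hAm n).diff (hAm _))]
      congr 1
      ext ω
      have := @hsub ω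
      simp only [Set.mem_compl_iff, Set.mem_union, Set.mem_sdiff]
      tauto
    have hb := bSeq_pos L a n
    have hb' := bSeq_pos L a (n + 1)
    have hbs := bSeq_succ L a hn
    have hmono : r ^ 2 / bSeq L a (n + 1) * P.real Aᶜ ≤ r ^ 2 / bSeq L a n * P.real Aᶜ := by
      gcongr
      rw [hbs]
      exact le_mul_of_one_le_right hb.le (by nlinarith [sq_nonneg (L * a n)])
    have hdiv : (∫ ω in A', Metric.infDist (x (n + 1) ω) X ^ 2 ∂P) / bSeq L a (n + 1) +
        r ^ 2 / bSeq L a (n + 1) * P.real (A \ A') +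
        (∫ ω in A, q n ω ∂P) / bSeq L a (n + 1) ≤
        (∫ ω in A, Metric.infDist (x n ω) X ^ 2 ∂P) / bSeq L a n +
        σ / I * (a n ^ 2 / bSeq L a (n + 1)) := by
      have hw : (1 + L ^ 2 * a n ^ 2) / bSeq L a (n + 1) = 1 / bSeq L a n := by
        rw [hbs]
        have : (1 + L ^ 2 * a n ^ 2) ≠ 0 := by positivity
        field_simp
      calc _ = (∫ ω in A', Metric.infDist (x (n + 1) ω) X ^ 2 ∂P +
            r ^ 2 * P.real (A \ A') + ∫ ω in A, q n ω ∂P) / bSeq L a (n + 1) := by ring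
        _ ≤ ((1 + L ^ 2 * a n ^ 2) * ∫ ω in A, Metric.infDist (x n ω) X ^ 2 ∂P
            + a n ^ 2 * (σ / I)) / bSeq L a (n + 1) := by
            refine div_le_div_of_nonneg_right ?_ hb'.le
            linarith
        _ = (1 + L ^ 2 * a n ^ 2) / bSeq L a (n + 1) *
            ∫ ω in A, Metric.infDist (x n ω) X ^ 2 ∂P +
            σ / I * (a n ^ 2 / bSeq L a (n + 1)) := by ring
        _ = _ := by rw [hw]; ring
    rw [Finset.sum_Ico_succ_top hn, lyapunovInit_succ X L σ I a x₁ hn, hcompl, mul_add]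
    linarith

lemma SGDSetting.measureReal_compl_stayEvent_le {d : ℕ} {Ω S : Type*} [MeasurableSpace Ω]
    [MeasurableSpace S] {P : Measure Ω} [IsProbabilityMeasure P] {ν : Measure S}
    {f : RSpace d → ℝ} {fstar : ℝ} {X : Set (RSpace d)} {r L σ : ℝ}
    {ξ : RSpace d → S → RSpace d} {I : ℕ} {a : ℕ → ℝ} {x₁ : RSpace d} {x : ℕ → Ω → RSpace d}
    (hf : LocLipGradient f) (hmin : IsLeast (Set.range f) fstar) (hXc : IsCompact X)
    (hX : X ⊆ {y | f y = fstar}) (hr : 0 < r) (hs : SGDSetting P ν f X r L σ ξ I a x₁ x)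
    {h : RSpace d → ℝ} (hh : NNS f X r h) {N : ℕ} (hN : 1 ≤ N) :
    P.real (stayEvent X r x N)ᶜ ≤ exitBound X r L σ I a x₁ N := by
  obtain ⟨hAm, hDm, hDi, q, hq⟩ := hs.exists_drift hf hmin hXc hX hr.le
  have hly := hs.lyapunov_inequality hr.le hAm (q := q)
    (fun n hn => ⟨(hq n hn).2.2.2.1, (hq n hn).2.2.2.2⟩) hN
  have hb := bSeq_pos L a N
  have h1 : 0 ≤ ∑ n ∈ Finset.Ico 1 N,
      (∫ ω in stayEvent X r x n, q n ω ∂P) / bSeq L a (n + 1) := by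
    refine Finset.sum_nonneg fun n hn => div_nonneg ?_ (bSeq_pos L a _).le
    have hn1 := (Finset.mem_Ico.1 hn).1
    refine setIntegral_nonneg (hAm n) fun ω hω => ?_
    have hmem := mem_closedNbhd_of_mem_stayEvent hn1 hω
    obtain ⟨p, hp⟩ := metricProj_nonempty hXc (nonempty_of_mem_closedNbhd hs.init) (x n ω)
    have han := hs.steps.pos n hn1
    exact (mul_nonneg (by positivity) ((hh _ hmem).1.trans ((hh _ hmem).2 p hp))).trans
      ((hq n hn1).2.2.1 ω hω p hp)
  have h2 : 0 ≤ (∫ ω in stayEvent X r x N, Metric.infDist (x N ω) X ^ 2 ∂P) / bSeq L a N :=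
    div_nonneg (integral_nonneg fun _ => sq_nonneg _) hb.le
  have h3 : r ^ 2 / bSeq L a N * P.real (stayEvent X r x N)ᶜ ≤
      lyapunovInit X L σ I a x₁ N := by linarith
  calc P.real (stayEvent X r x N)ᶜ
      = bSeq L a N / r ^ 2 * (r ^ 2 / bSeq L a N * P.real (stayEvent X r x N)ᶜ) := by
        field_simp
    _ ≤ _ := by unfold exitBound; gcongr

lemma SGDSetting.measureReal_minUpTo_le {d : ℕ} {Ω S : Type*} [MeasurableSpace Ω]
    [MeasurableSpace S] {P : Measure Ω} [IsProbabilityMeasure P] {ν : Measure S}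
    {f : RSpace d → ℝ} {fstar : ℝ} {X : Set (RSpace d)} {r L σ : ℝ}
    {ξ : RSpace d → S → RSpace d} {I : ℕ} {a : ℕ → ℝ} {x₁ : RSpace d} {x : ℕ → Ω → RSpace d}
    (hf : LocLipGradient f) (hmin : IsLeast (Set.range f) fstar) (hXc : IsCompact X)
    (hX : X ⊆ {y | f y = fstar}) (hr : 0 < r) (hs : SGDSetting P ν f X r L σ ξ I a x₁ x)
    {h : RSpace d → ℝ} (hh : NNS f X r h) {ε : ℝ} (hε : 0 < ε) {N : ℕ} (hN : 1 ≤ N) :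
    P.real {ω | minUpTo (fun n => h (x n ω)) N hN > ε} ≤
      1 / ε * (lyapunovInit X L σ I a x₁ (N + 1) /
          (2 * ∑ n ∈ Finset.Icc 1 N, a n / bSeq L a (n + 1)))
        + exitBound X r L σ I a x₁ (N + 1) := by
  have hexit := hs.measureReal_compl_stayEvent_le hf hmin hXc hX hr hh
    (N := N + 1) (by omega)
  obtain ⟨hAm, hDm, hDi, q, hq⟩ := hs.exists_drift hf hmin hXc hX hr.le
  have hly := hs.lyapunov_inequality hr.le hAm (q := q)
    (fun n hn => ⟨(hq n hn).2.2.2.1, (hq n hn).2.2.2.2⟩) (N := N + 1) (by omega)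
  have hne := nonempty_of_mem_closedNbhd hs.init
  have hlower : ∀ n, 1 ≤ n → ∀ ω ∈ stayEvent X r x n, 2 * a n * h (x n ω) ≤ q n ω := by
    intro n hn ω hω
    obtain ⟨p, hp⟩ := metricProj_nonempty hXc hne (x n ω)
    have han := hs.steps.pos n hn
    refine le_trans ?_ ((hq n hn).2.2.1 ω hω p hp)
    gcongr
    exact (hh _ (mem_closedNbhd_of_mem_stayEvent hn hω)).2 p hp
  have hq0 : ∀ n, 1 ≤ n → ∀ ω ∈ stayEvent X r x n, 0 ≤ q n ω := fun n hn ω hω =>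
    (mul_nonneg (by have := hs.steps.pos n hn; positivity)
      (hh _ (mem_closedNbhd_of_mem_stayEvent hn hω)).1).trans (hlower n hn ω hω)
  -- `h` need not be measurable, so the event is replaced by one expressed through the drift
  let B : Set Ω := stayEvent X r x (N + 1) ∩ ⋂ n ∈ Finset.Icc 1 N, {ω | 2 * a n * ε ≤ q n ω}
  have hBm : MeasurableSet B := (hAm _).inter
    (Finset.measurableSet_biInter _ fun n hn =>
      measurableSet_le measurable_const (hq n (Finset.mem_Icc.1 hn).1).1)
  have hsub : {ω | minUpTo (fun n => h (x n ω)) N hN > ε} ⊆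
      B ∪ (stayEvent X r x (N + 1))ᶜ := by
    intro ω hω
    by_cases hA : ω ∈ stayEvent X r x (N + 1)
    · refine Or.inl ⟨hA, Set.mem_iInter₂.2 fun n hn => ?_⟩
      have hn' := Finset.mem_Icc.1 hn
      have hlt : ε < h (x n ω) :=
        (Finset.lt_inf'_iff (f := fun n => h (x n ω)) (Finset.nonempty_Icc.2 hN)).1 hω n hn
      have han := hs.steps.pos n hn'.1
      refine le_trans ?_ (hlower n hn'.1 ω (stayEvent_antitone X r x (by omega) hA))
      change 2 * a n * ε ≤ 2 * a n * h (x n ω)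
      gcongr
    · exact Or.inr hA
  have hBsub : ∀ n, n ≤ N → B ⊆ stayEvent X r x n := fun n hn ω hω =>
    stayEvent_antitone X r x (by omega) hω.1
  have hBq : ∀ n ∈ Finset.Icc 1 N,
      2 * a n * ε * P.real B ≤ ∫ ω in stayEvent X r x n, q n ω ∂P := by
    intro n hn
    have hn' := Finset.mem_Icc.1 hn
    refine le_trans (setIntegral_ge_of_const_le_real hBm (measure_ne_top _ _)
      (fun ω hω => Set.mem_iInter₂.1 hω.2 n hn)
      ((hq n hn'.1).2.1.mono_set (hBsub n hn'.2))) ?_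
    exact setIntegral_mono_set (hq n hn'.1).2.1 ((ae_restrict_iff' (hAm n)).2
      (Filter.Eventually.of_forall (hq0 n hn'.1))) (hBsub n hn'.2).eventuallyLE
  have hpos : 0 < ∑ n ∈ Finset.Icc 1 N, a n / bSeq L a (n + 1) :=
    Finset.sum_pos (fun n hn => div_pos (hs.steps.pos n (Finset.mem_Icc.1 hn).1)
      (bSeq_pos L a _)) (Finset.nonempty_Icc.2 hN)
  have hmain : (2 * ∑ n ∈ Finset.Icc 1 N, a n / bSeq L a (n + 1)) * ε * P.real B ≤
      lyapunovInit X L σ I a x₁ (N + 1) := by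
    have h1 : (2 * ∑ n ∈ Finset.Icc 1 N, a n / bSeq L a (n + 1)) * ε * P.real B ≤
        ∑ n ∈ Finset.Icc 1 N,
          (∫ ω in stayEvent X r x n, q n ω ∂P) / bSeq L a (n + 1) := by
      rw [Finset.mul_sum, Finset.sum_mul, Finset.sum_mul]
      refine Finset.sum_le_sum fun n hn => ?_
      have := (div_le_div_iff_of_pos_right (bSeq_pos L a (n + 1))).2 (hBq n hn)
      calc _ = 2 * a n * ε * P.real B / bSeq L a (n + 1) := by ring
        _ ≤ _ := this
    have h2 : 0 ≤ r ^ 2 / bSeq L a (N + 1) * P.real (stayEvent X r x (N + 1))ᶜ :=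
      mul_nonneg (div_nonneg (sq_nonneg _) (bSeq_pos L a _).le) measureReal_nonneg
    have h3 : 0 ≤ (∫ ω in stayEvent X r x (N + 1),
        Metric.infDist (x (N + 1) ω) X ^ 2 ∂P) / bSeq L a (N + 1) :=
      div_nonneg (integral_nonneg fun _ => sq_nonneg _) (bSeq_pos L a _).le
    have h4 : Finset.Ico 1 (N + 1) = Finset.Icc 1 N := by
      ext n; simp only [Finset.mem_Ico, Finset.mem_Icc]; omega
    rw [h4] at hly
    linarith
  calc P.real {ω | minUpTo (fun n => h (x n ω)) N hN > ε}
      ≤ P.real (B ∪ (stayEvent X r x (N + 1))ᶜ) := measureReal_mono hsub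
    _ ≤ P.real B + P.real (stayEvent X r x (N + 1))ᶜ := measureReal_union_le _ _
    _ ≤ _ := by
        gcongr
        rw [one_div, ← div_eq_inv_mul, div_div, le_div_iff₀ (by positivity)]
        linarith

/-! ### Rates for polynomially decreasing learning rates -/

lemma SGDSetting.exists_bound_of_WQC {d : ℕ} {Ω S : Type*} [MeasurableSpace Ω]
    [MeasurableSpace S] {P : Measure Ω} [IsProbabilityMeasure P] {ν : Measure S}
    {f : RSpace d → ℝ} {fstar : ℝ} {X : Set (RSpace d)} {r L σ : ℝ}
    {ξ : RSpace d → S → RSpace d} {I : ℕ} {a : ℕ → ℝ} {x₁ : RSpace d} {x : ℕ → Ω → RSpace d}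
    (hf : LocLipGradient f) (hmin : IsLeast (Set.range f) fstar) (hXc : IsCompact X)
    (hX : X ⊆ {y | f y = fstar}) (hr : 0 < r) (hs : SGDSetting P ν f X r L σ ξ I a x₁ x)
    {a₀ β : ℝ} (ha₀ : 0 < a₀) (hβ0 : 0 ≤ β) (ha : ∀ n : ℕ, 1 ≤ n → a n = a₀ / (n : ℝ) ^ β)
    (hW : WQC f fstar X r) :
    ∃ K : ℝ, ∀ ε : ℝ, 0 < ε → ∀ (N : ℕ) (hN : 1 ≤ N),
      P.real {ω | minUpTo (fun n => f (x n ω)) N hN - fstar > ε} ≤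
        K / (ε * (N : ℝ) ^ (1 - β)) + exitBound X r L σ I a x₁ (N + 1) := by
  obtain ⟨ζ, hζ, -, hW⟩ := hW
  have hNNS : NNS f X r fun y => ζ * (f y - fstar) := fun y hy =>
    ⟨mul_nonneg hζ.le (sub_nonneg.2 (hmin.2 (Set.mem_range_self y))), hW y hy⟩
  set Λ := Metric.infDist x₁ X ^ 2 + σ / I * ∑' k, a (k + 1) ^ 2 with hΛ
  set B := Real.exp (L ^ 2 * ∑' k, a (k + 1) ^ 2) with hB
  have hBpos : 0 < B := Real.exp_pos _
  refine ⟨Λ * B / (2 * ζ * a₀), fun ε hε N hN => ?_⟩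
  have hN0 : (0 : ℝ) < N := by exact_mod_cast hN
  have hsub : {ω | minUpTo (fun n => f (x n ω)) N hN - fstar > ε} ⊆
      {ω | minUpTo (fun n => ζ * (f (x n ω) - fstar)) N hN > ζ * ε} := by
    intro ω hω
    refine (Finset.lt_inf'_iff (f := fun n => ζ * (f (x n ω) - fstar)) _).2 fun n hn => ?_
    have h1 : fstar + ε < minUpTo (fun n => f (x n ω)) N hN := by
      have : ε < minUpTo (fun n => f (x n ω)) N hN - fstar := hω
      linarith
    have h2 := (Finset.lt_inf'_iff (f := fun n => f (x n ω)) (Finset.nonempty_Icc.2 hN)).1 h1 n hn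
    have : ε < f (x n ω) - fstar := by linarith
    gcongr
  have hmain := hs.measureReal_minUpTo_le hf hmin hXc hX hr hNNS (mul_pos hζ hε) hN
  refine (measureReal_mono hsub).trans (hmain.trans ?_)
  gcongr
  -- the learning rates decrease and `1 ≤ b_n ≤ B`, so the sum is at least `N` times its last term
  have hsum : a₀ * (N : ℝ) ^ (1 - β) / B ≤ ∑ n ∈ Finset.Icc 1 N, a n / bSeq L a (n + 1) := by
    have hterm : ∀ n ∈ Finset.Icc 1 N, a₀ / (N : ℝ) ^ β / B ≤ a n / bSeq L a (n + 1) := by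
      intro n hn
      obtain ⟨hn1, hnN⟩ := Finset.mem_Icc.1 hn
      have hn0 : (0 : ℝ) < n := by exact_mod_cast hn1
      rw [ha n hn1]
      have h1 := bSeq_le_exp (L := L) hs.steps.sum_sq (n + 1)
      have h2 := bSeq_pos L a (n + 1)
      gcongr
    calc a₀ * (N : ℝ) ^ (1 - β) / B = ∑ _n ∈ Finset.Icc 1 N, a₀ / (N : ℝ) ^ β / B := by
          rw [Finset.sum_const, Nat.card_Icc, nsmul_eq_mul, Real.rpow_sub hN0, Real.rpow_one]
          simp only [Nat.add_sub_cancel]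
          ring
      _ ≤ _ := Finset.sum_le_sum hterm
  have hpow : (0 : ℝ) < (N : ℝ) ^ (1 - β) := Real.rpow_pos_of_pos hN0 _
  have hly0 := lyapunovInit_nonneg X L hs.σ_pos.le I a x₁ (N + 1)
  have hly := lyapunovInit_le X L hs.σ_pos.le I hs.steps.sum_sq x₁ (N + 1)
  calc 1 / (ζ * ε) * (lyapunovInit X L σ I a x₁ (N + 1) /
          (2 * ∑ n ∈ Finset.Icc 1 N, a n / bSeq L a (n + 1)))
      ≤ 1 / (ζ * ε) * (Λ / (2 * (a₀ * (N : ℝ) ^ (1 - β) / B))) := by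
        gcongr
        exact hly0.trans hly
    _ = Λ * B / (2 * ζ * a₀) / (ε * (N : ℝ) ^ (1 - β)) := by field_simp

/-- A recursion of Chung type: with steps `a₀ / n^β`, `β < 1`, the contraction `1 - μ a_n` beats
the decrease of `a_n`, so the solution is of the order of the steps themselves. -/
lemma exists_le_div_rpow_of_recursion {e a : ℕ → ℝ} {a₀ β μ c v : ℝ}
    (ha₀ : 0 < a₀) (hβ0 : 0 < β) (hβ1 : β < 1) (hμ : 0 < μ) (he : ∀ n, 0 ≤ e n)
    (ha : ∀ n : ℕ, 1 ≤ n → a n = a₀ / (n : ℝ) ^ β)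
    (hrec : ∀ n, 1 ≤ n → e (n + 1) ≤ (1 + c * a n ^ 2 - 2 * μ * a n) * e n + v * a n ^ 2) :
    ∃ K : ℝ, 0 ≤ K ∧ ∀ n : ℕ, 1 ≤ n → e n ≤ K / (n : ℝ) ^ β := by
  have hatop : Filter.Tendsto (fun n : ℕ => a₀ / (n : ℝ) ^ β) Filter.atTop (nhds 0) :=
    ((tendsto_rpow_atTop hβ0).comp tendsto_natCast_atTop_atTop).const_div_atTop a₀
  have hnatop : Filter.Tendsto (fun n : ℕ => a₀ * (n : ℝ) ^ (1 - β)) Filter.atTop Filter.atTop :=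
    ((tendsto_rpow_atTop (sub_pos.2 hβ1)).comp tendsto_natCast_atTop_atTop).const_mul_atTop ha₀
  have hcl : Filter.Tendsto (fun n : ℕ => c * (a₀ / (n : ℝ) ^ β)) Filter.atTop (nhds 0) := by
    simpa using hatop.const_mul c
  have hml : Filter.Tendsto (fun n : ℕ => μ * (a₀ / (n : ℝ) ^ β)) Filter.atTop (nhds 0) := by
    simpa using hatop.const_mul μ
  obtain ⟨m, hm⟩ := Filter.eventually_atTop.1
    ((hcl.eventually_lt_const hμ).and ((hml.eventually_lt_const one_pos).and
      ((hnatop.eventually_ge_atTop (2 / μ)).and (Filter.eventually_ge_atTop 1))))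
  -- from the index `m` on, the bound `κ a_n` propagates as soon as `2 v ≤ μ κ`
  set κ := 2 * |v| / μ + ∑ n ∈ Finset.Icc 1 m, e n / a n with hκ
  have hapos : ∀ n : ℕ, 1 ≤ n → 0 < a n := fun n hn => by
    have : (0 : ℝ) < n := by exact_mod_cast hn
    rw [ha n hn]; positivity
  have hterm : ∀ n ∈ Finset.Icc 1 m, 0 ≤ e n / a n := fun n hn =>
    div_nonneg (he n) (hapos n (Finset.mem_Icc.1 hn).1).le
  have hsum0 : 0 ≤ ∑ n ∈ Finset.Icc 1 m, e n / a n := Finset.sum_nonneg hterm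
  have hκ0 : 0 ≤ κ := by positivity
  have hκv : v ≤ μ / 2 * κ := by
    have : μ / 2 * κ = |v| + μ / 2 * ∑ n ∈ Finset.Icc 1 m, e n / a n := by
      rw [hκ]; field_simp
    have h2 : 0 ≤ μ / 2 * ∑ n ∈ Finset.Icc 1 m, e n / a n := by positivity
    linarith [le_abs_self v]
  have hsmall : ∀ n, 1 ≤ n → n ≤ m → e n ≤ κ * a n := by
    intro n hn hnm
    rw [← div_le_iff₀ (hapos n hn)]
    have := Finset.single_le_sum hterm (Finset.mem_Icc.2 ⟨hn, hnm⟩)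
    have h2 : 0 ≤ 2 * |v| / μ := by positivity
    linarith
  have hlarge : ∀ n, m ≤ n → e n ≤ κ * a n := by
    intro n hn
    induction n, hn using Nat.le_induction with
    | base => exact hsmall m (hm m le_rfl).2.2.2 le_rfl
    | succ n hn ih =>
      obtain ⟨h1, h2, h3, h4⟩ := hm n hn
      rw [← ha n h4] at h1 h2
      have hn0 : (0 : ℝ) < n := by exact_mod_cast h4
      have han := hapos n h4
      have hdec : a n - a (n + 1) ≤ μ / 2 * a n ^ 2 := by
        have hpow : ((n : ℝ) + 1) ^ β ≤ (n : ℝ) ^ β * (1 + 1 / n) := by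
          have : (n : ℝ) + 1 = n * (1 + 1 / n) := by field_simp
          rw [this, Real.mul_rpow hn0.le (by positivity)]
          gcongr
          exact Real.rpow_le_self_of_one_le (by simp) hβ1.le
        have hnext : a n * (1 - 1 / n) ≤ a (n + 1) := by
          rw [ha n h4, ha (n + 1) (by omega), Nat.cast_add, Nat.cast_one]
          have hp : 0 < (n : ℝ) ^ β := by positivity
          calc a₀ / (n : ℝ) ^ β * (1 - 1 / n)
              ≤ a₀ / (n : ℝ) ^ β * (1 / (1 + 1 / n)) := by
                gcongr
                rw [le_div_iff₀ (by positivity)]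
                nlinarith [sq_nonneg (1 / (n : ℝ))]
            _ = a₀ / ((n : ℝ) ^ β * (1 + 1 / n)) := by field_simp
            _ ≤ _ := by gcongr
        have hna : a n * n = a₀ * (n : ℝ) ^ (1 - β) := by
          rw [ha n h4, Real.rpow_sub hn0, Real.rpow_one]; ring
        have hinv : a n * (1 / n) ≤ μ / 2 * a n ^ 2 := by
          rw [← hna, div_le_iff₀ hμ] at h3
          rw [mul_one_div, div_le_iff₀ hn0]
          nlinarith
        linarith
      have hstep : e (n + 1) ≤ (1 - μ * a n) * e n + v * a n ^ 2 := by
        refine (hrec n h4).trans ?_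
        have : (1 + c * a n ^ 2 - 2 * μ * a n) * e n ≤ (1 - μ * a n) * e n := by
          refine mul_le_mul_of_nonneg_right ?_ (he n)
          nlinarith
        linarith
      have hprop : (1 - μ * a n) * e n ≤ (1 - μ * a n) * (κ * a n) :=
        mul_le_mul_of_nonneg_left ih (by linarith)
      have hv2 : v * a n ^ 2 ≤ μ / 2 * κ * a n ^ 2 :=
        mul_le_mul_of_nonneg_right hκv (sq_nonneg _)
      have hκd := mul_le_mul_of_nonneg_left hdec hκ0
      nlinarith
  refine ⟨κ * a₀, by positivity, fun n hn => ?_⟩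
  rw [mul_div_assoc, ← ha n hn]
  exact (le_total n m).elim (hsmall n hn) (hlarge n)

lemma sub_le_of_mem_closedNbhd {d : ℕ} {f : RSpace d → ℝ} {fstar : ℝ} {X : Set (RSpace d)}
    {r L : ℝ} (hf : Differentiable ℝ f) (hmin : IsLeast (Set.range f) fstar)
    (hXc : IsCompact X) (hX : X ⊆ {y | f y = fstar}) (hr : 0 ≤ r) (hL0 : 0 ≤ L)
    (hL : ∀ y ∈ closedNbhd r X, ∀ z ∈ closedNbhd r X,
      ‖gradient f y - gradient f z‖ ≤ L * ‖y - z‖)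
    {x : RSpace d} (hx : x ∈ closedNbhd r X) : f x - fstar ≤ L * Metric.infDist x X ^ 2 := by
  have hne := nonempty_of_mem_closedNbhd hx
  obtain ⟨p, hp⟩ := metricProj_nonempty hXc hne x
  have hxr := (mem_closedNbhd_iff hne hr).1 hx
  have hbound : ∀ z ∈ segment ℝ p x, ‖fderiv ℝ f z‖ ≤ L * Metric.infDist x X := by
    intro z hz
    have hzp : ‖z - p‖ ≤ Metric.infDist x X := by
      obtain ⟨t, ⟨ht0, ht1⟩, rfl⟩ := (segment_eq_image' ℝ p x ▸ hz :)
      rw [add_sub_cancel_left, norm_smul, Real.norm_of_nonneg ht0, hp.2]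
      exact mul_le_of_le_one_left Metric.infDist_nonneg ht1
    have hzr : z ∈ closedNbhd r X := (mem_closedNbhd_iff hne hr).2
      ((Metric.infDist_le_dist_of_mem hp.1).trans (by rw [dist_eq_norm]; linarith))
    have h := hL z hzr p (Metric.self_subset_cthickening X hp.1)
    rw [gradient_eq_zero_of_isLeast hmin (hX hp.1), sub_zero, gradient,
      LinearIsometryEquiv.norm_map] at h
    exact h.trans (by gcongr)
  have h := (convex_segment p x).norm_image_sub_le_of_norm_fderiv_le
    (fun z _ => hf z) hbound (left_mem_segment ℝ p x) (right_mem_segment ℝ p x)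
  rw [hp.2, show f p = fstar from hX hp.1] at h
  calc f x - fstar ≤ ‖f x - fstar‖ := Real.le_norm_self _
    _ ≤ _ := h
    _ = _ := by ring

lemma SGDSetting.exists_bound_of_LRSI {d : ℕ} {Ω S : Type*} [MeasurableSpace Ω]
    [MeasurableSpace S] {P : Measure Ω} [IsProbabilityMeasure P] {ν : Measure S}
    {f : RSpace d → ℝ} {fstar : ℝ} {X : Set (RSpace d)} {r L σ : ℝ}
    {ξ : RSpace d → S → RSpace d} {I : ℕ} {a : ℕ → ℝ} {x₁ : RSpace d} {x : ℕ → Ω → RSpace d}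
    (hf : LocLipGradient f) (hmin : IsLeast (Set.range f) fstar) (hXc : IsCompact X)
    (hX : X ⊆ {y | f y = fstar}) (hr : 0 < r) (hs : SGDSetting P ν f X r L σ ξ I a x₁ x)
    {a₀ β : ℝ} (ha₀ : 0 < a₀) (hβ0 : 0 < β) (hβ1 : β < 1)
    (ha : ∀ n : ℕ, 1 ≤ n → a n = a₀ / (n : ℝ) ^ β) (hR : LRSI f X r) :
    ∃ K : ℝ, ∀ ε : ℝ, 0 < ε → ∀ N : ℕ, 1 ≤ N →
      P.real {ω | f (x N ω) - fstar > ε} ≤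
        K / (ε * (N : ℝ) ^ β) + exitBound X r L σ I a x₁ (N + 1) := by
  obtain ⟨μ, hμ, hR⟩ := hR
  have hNNS : NNS f X r fun _ => 0 := fun y hy => ⟨le_rfl, fun p hp =>
    (by positivity : (0 : ℝ) ≤ μ * ‖y - p‖ ^ 2).trans (hR y hy p hp)⟩
  obtain ⟨hAm, hDm, hDi, q, hq⟩ := hs.exists_drift hf hmin hXc hX hr.le
  have hne := nonempty_of_mem_closedNbhd hs.init
  set e : ℕ → ℝ := fun n => ∫ ω in stayEvent X r x n, Metric.infDist (x n ω) X ^ 2 ∂P with he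
  have hrec : ∀ n, 1 ≤ n →
      e (n + 1) ≤ (1 + L ^ 2 * a n ^ 2 - 2 * μ * a n) * e n + σ / I * a n ^ 2 := by
    intro n hn
    obtain ⟨hqm, hqi, hql, hDi', hle⟩ := hq n hn
    have h1 : e (n + 1) ≤ ∫ ω in stayEvent X r x n, Metric.infDist (x (n + 1) ω) X ^ 2 ∂P :=
      setIntegral_mono_set hDi' (Filter.Eventually.of_forall fun _ => sq_nonneg _)
        (stayEvent_antitone X r x n.le_succ).eventuallyLE
    have h2 : 2 * a n * μ * e n ≤ ∫ ω in stayEvent X r x n, q n ω ∂P := by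
      rw [he, ← integral_const_mul]
      refine setIntegral_mono_on ((hDi n hn).const_mul _) hqi (hAm n) fun ω hω => ?_
      obtain ⟨p, hp⟩ := metricProj_nonempty hXc hne (x n ω)
      have h := hR _ (mem_closedNbhd_of_mem_stayEvent hn hω) p hp
      rw [hp.2] at h
      have han := hs.steps.pos n hn
      refine le_trans ?_ (hql ω hω p hp)
      rw [mul_assoc]
      gcongr
    simp only [he] at h1 h2 hle ⊢
    linarith
  obtain ⟨K, hK0, hK⟩ := exists_le_div_rpow_of_recursion (e := e) ha₀ hβ0 hβ1 hμ
    (fun n => integral_nonneg fun _ => sq_nonneg _) ha hrec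
  refine ⟨L * K, fun ε hε N hN => ?_⟩
  have hexit := hs.measureReal_compl_stayEvent_le hf hmin hXc hX hr hNNS
    (N := N + 1) (by omega)
  have hN0 : (0 : ℝ) < N := by exact_mod_cast hN
  have hLp := hs.L_pos
  set B := stayEvent X r x N ∩ {ω | ε ≤ L * Metric.infDist (x N ω) X ^ 2} with hB
  have hBm : MeasurableSet B :=
    (hAm N).inter (measurableSet_le measurable_const ((hDm N hN).const_mul L))
  have hsub : {ω | f (x N ω) - fstar > ε} ⊆ B ∪ (stayEvent X r x (N + 1))ᶜ := by
    intro ω hω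
    by_cases hA : ω ∈ stayEvent X r x (N + 1)
    · have hA' := stayEvent_antitone X r x N.le_succ hA
      exact Or.inl ⟨hA', (le_of_lt hω).trans (sub_le_of_mem_closedNbhd hf.1 hmin hXc hX hr.le
        hLp.le hs.lipschitz (mem_closedNbhd_of_mem_stayEvent hN hA'))⟩
    · exact Or.inr hA
  have hBle : ε * P.real B ≤ L * e N := by
    have hi : IntegrableOn (fun ω => L * Metric.infDist (x N ω) X ^ 2) (stayEvent X r x N) P :=
      (hDi N hN).const_mul L
    refine (setIntegral_ge_of_const_le_real hBm (measure_ne_top _ _) (fun ω hω => hω.2)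
      (hi.mono_set Set.inter_subset_left)).trans ?_
    rw [he, ← integral_const_mul]
    exact setIntegral_mono_set hi (Filter.Eventually.of_forall fun _ => by positivity)
      (Set.inter_subset_left : B ⊆ _).eventuallyLE
  have hp : (0 : ℝ) < (N : ℝ) ^ β := Real.rpow_pos_of_pos hN0 _
  calc P.real {ω | f (x N ω) - fstar > ε}
      ≤ P.real (B ∪ (stayEvent X r x (N + 1))ᶜ) := measureReal_mono hsub
    _ ≤ P.real B + P.real (stayEvent X r x (N + 1))ᶜ := measureReal_union_le _ _
    _ ≤ _ := by
        gcongr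
        have h : ε * P.real B ≤ L * (K / (N : ℝ) ^ β) := hBle.trans (by gcongr; exact hK N hN)
        rw [le_div_iff₀ (by positivity)]
        rw [mul_div_assoc', le_div_iff₀ hp] at h
        linarith

/-! ### The restricted secant inequality from a Hessian of constant rank -/

lemma ContDiffAt.gradient_of_three {d : ℕ} {f : RSpace d → ℝ} {p : RSpace d}
    (h : ContDiffAt ℝ 3 f p) : ContDiffAt ℝ 2 (gradient f) p := by
  have h1 : ContDiffAt ℝ 2 (fderiv ℝ f) p := h.fderiv_right (by norm_num)
  exact (InnerProductSpace.toDual ℝ (RSpace d)).symm.contDiff.contDiffAt.comp p h1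

lemma hasStrictFDerivAt_gradient {d : ℕ} {f : RSpace d → ℝ} {p : RSpace d}
    (h : ContDiffAt ℝ 3 f p) : HasStrictFDerivAt (gradient f) (hessian f p) p :=
  h.gradient_of_three.hasStrictFDerivAt (by norm_num)

lemma inner_hessian_comm {d : ℕ} {f : RSpace d → ℝ} {p : RSpace d}
    (h : ContDiffAt ℝ 3 f p) (u v : RSpace d) :
    inner ℝ (hessian f p u) v = inner ℝ (hessian f p v) u := by
  have hsymm : IsSymmSndFDerivAt ℝ f p := h.isSymmSndFDerivAt (by
    rw [minSmoothness_of_isRCLikeNormedField]; norm_num)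
  have hd : DifferentiableAt ℝ (fderiv ℝ f) p :=
    (h.fderiv_right (m := 2) (by norm_num)).differentiableAt (by norm_num)
  have key : ∀ u v, inner ℝ (hessian f p u) v = fderiv ℝ (fderiv ℝ f) p u v := by
    intro u v
    have h1 : HasFDerivAt (fun x => inner ℝ v (gradient f x))
        ((innerSL ℝ v).comp (hessian f p)) p :=
      (innerSL ℝ v).hasFDerivAt.comp p (hasStrictFDerivAt_gradient h).hasFDerivAt
    have h2 := hd.hasFDerivAt.clm_apply (hasFDerivAt_const v p)
    have heq : (fun x => inner ℝ v (gradient f x)) = fun x => fderiv ℝ f x v := by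
      funext x
      rw [real_inner_comm, inner_gradient_left]
    rw [heq] at h1
    have h3 := congrArg (· u) (h1.unique h2)
    rw [real_inner_comm]
    simpa using h3
  rw [key, key]
  exact hsymm u v

lemma inner_hessian_self_nonneg {d : ℕ} {f : RSpace d → ℝ} {p : RSpace d}
    (hf : Differentiable ℝ f) (h : ContDiffAt ℝ 3 f p) (hp : ∀ y, f p ≤ f y) (v : RSpace d) :
    0 ≤ inner ℝ (hessian f p v) v := by
  by_contra! hneg
  have hline : ∀ t : ℝ, HasDerivAt (fun t : ℝ => p + t • v) v t := fun t => by
    simpa using ((hasDerivAt_id t).smul_const v).const_add p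
  have hg0 : gradient f p = 0 := gradient_eq_zero_of_isLeast
    (fstar := f p) ⟨⟨p, rfl⟩, by rintro _ ⟨y, rfl⟩; exact hp y⟩ rfl
  have hφ : HasDerivAt (fun t : ℝ => inner ℝ (gradient f (p + t • v)) v)
      (inner ℝ (hessian f p v) v) 0 := by
    have h1 : HasFDerivAt (gradient f) (hessian f p) (p + (0 : ℝ) • v) := by
      simpa using (hasStrictFDerivAt_gradient h).hasFDerivAt
    have h2 := (h1.comp_hasDerivAt (0 : ℝ) (hline 0)).inner ℝ (hasDerivAt_const (0 : ℝ) v)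
    simpa using h2
  have hev : ∀ᶠ t in nhdsWithin (0 : ℝ) (Set.Ioi 0),
      inner ℝ (gradient f (p + t • v)) v < 0 := by
    have hs := (hasDerivAt_iff_tendsto_slope.1 hφ).mono_left
      (nhdsWithin_mono (0 : ℝ) fun t (ht : t ∈ Set.Ioi (0 : ℝ)) => ne_of_gt ht)
    filter_upwards [hs.eventually_lt_const hneg, self_mem_nhdsWithin] with t ht ht0
    rw [slope_def_field] at ht
    simp only [zero_smul, add_zero, hg0, inner_zero_left, sub_zero] at ht
    exact (div_neg_iff.1 ht).elim (fun h => absurd ht0 (not_lt.2 h.2.le)) (·.1)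
  obtain ⟨δ, hδ, hδs⟩ := mem_nhdsGT_iff_exists_Ioo_subset.1 hev
  have hδ0 : (0 : ℝ) < δ := hδ
  have hder : ∀ t : ℝ, HasDerivAt (fun t : ℝ => f (p + t • v))
      (inner ℝ (gradient f (p + t • v)) v) t := fun t => by
    rw [inner_gradient_left]
    exact (hf (p + t • v)).hasFDerivAt.comp_hasDerivAt t (hline t)
  obtain ⟨c, hc, hceq⟩ := exists_hasDerivAt_eq_slope (fun t : ℝ => f (p + t • v))
    (fun t => inner ℝ (gradient f (p + t • v)) v) hδ0
    (fun t _ => (hder t).continuousAt.continuousWithinAt) fun t _ => hder t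
  have hlt : inner ℝ (gradient f (p + c • v)) v < 0 := hδs hc
  rw [hceq] at hlt
  have : 0 ≤ f (p + δ • v) - f (p + (0 : ℝ) • v) := by
    rw [zero_smul, add_zero]; exact sub_nonneg.2 (hp _)
  exact absurd hlt (not_lt.2 (div_nonneg this (by linarith)))

/-- A symmetric positive semidefinite operator annihilates every vector on which its quadratic form
is not positive. -/
lemma apply_eq_zero_of_inner_self_nonpos {E : Type*} [NormedAddCommGroup E]
    [InnerProductSpace ℝ E] {H : E →L[ℝ] E} (hsymm : ∀ u v, inner ℝ (H u) v = inner ℝ (H v) u)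
    (hpos : ∀ v, 0 ≤ inner ℝ (H v) v) {u : E} (hu : inner ℝ (H u) u ≤ 0) : H u = 0 := by
  set c := inner ℝ (H (H u)) (H u) with hc
  set A := ‖H u‖ ^ 2 with hA
  have hc0 : 0 ≤ c := hpos _
  set t := A / (c + 1) with ht
  have hexp : inner ℝ (H (u - t • H u)) (u - t • H u) =
      inner ℝ (H u) u - 2 * t * A + t ^ 2 * c := by
    have h1 : inner ℝ (H (H u)) u = A := by rw [hsymm, real_inner_self_eq_norm_sq]
    simp only [map_sub, map_smul, inner_sub_left, inner_sub_right, inner_smul_left,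
      inner_smul_right, conj_trivial, h1, ← hc, real_inner_self_eq_norm_sq, ← hA]
    ring
  have h := hpos (u - t • H u)
  rw [hexp] at h
  have htc : t * (c + 1) = A := div_mul_cancel₀ _ (by positivity)
  have ht0 : 0 ≤ t := by positivity
  have hA0 : A = 0 := by nlinarith
  simpa [hA] using hA0

/-- The embedding of `ℝᵏ` into `ℝᵈ` as the subspace of the first `k` coordinates. -/
noncomputable def firstCoords {k d : ℕ} (h : k ≤ d) : (Fin k → ℝ) →ₗ[ℝ] RSpace d :=
  (WithLp.linearEquiv 2 ℝ (Fin d → ℝ)).symm.toLinearMap ∘ₗ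
    Function.ExtendByZero.linearMap ℝ (Fin.castLE h)

lemma firstCoords_injective {k d : ℕ} (h : k ≤ d) : Function.Injective (firstCoords h) := by
  intro c c' hcc
  ext i
  have := congrArg (fun v : RSpace d => v (Fin.castLE h i)) hcc
  simpa [firstCoords, (Fin.castLE_injective h).extend_apply] using this

lemma firstCoords_apply_eq_zero {k d : ℕ} (h : k ≤ d) (c : Fin k → ℝ) {i : Fin d}
    (hi : k ≤ (i : ℕ)) : firstCoords h c i = 0 := by
  have : ¬ ∃ j, Fin.castLE h j = i := by
    rintro ⟨j, rfl⟩
    exact absurd j.2 (not_lt.2 hi)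
  simp [firstCoords, Function.extend_apply' _ _ _ this]

section Chart

variable {d k : ℕ} {X : Set (RSpace d)} {φ : OpenPartialHomeomorph (RSpace d) (RSpace d)}

lemma hasFDerivAt_chart_symm (hψ : ContDiffOn ℝ 2 φ.symm φ.target) {p : RSpace d}
    (hp : p ∈ φ.source) : HasFDerivAt φ.symm (fderiv ℝ φ.symm (φ p)) (φ p) :=
  ((hψ.contDiffAt (φ.open_target.mem_nhds (φ.map_source hp))).differentiableAt
    (by norm_num)).hasFDerivAt

/-- A curve in `X` through `p`, a coordinate line in the chart. -/
lemma eventually_chart_symm_mem (hX : ∀ y ∈ φ.source, y ∈ X ↔ ∀ i : Fin d, k ≤ (i : ℕ) → φ y i = 0)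
    {p : RSpace d} (hp : p ∈ φ.source) (hpX : p ∈ X) {v : RSpace d}
    (hv : ∀ i : Fin d, k ≤ (i : ℕ) → v i = 0) :
    ∀ᶠ t in nhds (0 : ℝ), φ.symm (φ p + t • v) ∈ X := by
  have hc : Filter.Tendsto (fun t : ℝ => φ p + t • v) (nhds 0) (nhds (φ p)) := by
    have : Continuous fun t : ℝ => φ p + t • v := by fun_prop
    simpa using this.tendsto 0
  filter_upwards [hc.eventually (φ.open_target.mem_nhds (φ.map_source hp))] with t ht
  rw [hX _ (φ.map_target ht), φ.right_inv ht]
  intro i hi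
  simp [(hX p hp).1 hpX i hi, hv i hi]

lemma hasDerivAt_chart_symm_line (hψ : ContDiffOn ℝ 2 φ.symm φ.target) {p : RSpace d}
    (hp : p ∈ φ.source) (v : RSpace d) :
    HasDerivAt (fun t : ℝ => φ.symm (φ p + t • v)) (fderiv ℝ φ.symm (φ p) v) 0 := by
  have hline : HasDerivAt (fun t : ℝ => φ p + t • v) v 0 := by
    simpa using ((hasDerivAt_id (0 : ℝ)).smul_const v).const_add (φ p)
  have h1 : HasFDerivAt φ.symm (fderiv ℝ φ.symm (φ p)) (φ p + (0 : ℝ) • v) := by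
    simpa using hasFDerivAt_chart_symm hψ hp
  exact h1.comp_hasDerivAt (0 : ℝ) hline

/-- At a nearest point `p`, the vector `x - p` is orthogonal to the tangent space of `X`. -/
lemma inner_sub_tangent_eq_zero
    (hX : ∀ y ∈ φ.source, y ∈ X ↔ ∀ i : Fin d, k ≤ (i : ℕ) → φ y i = 0)
    (hψ : ContDiffOn ℝ 2 φ.symm φ.target) {x p : RSpace d} (hp : p ∈ φ.source)
    (hpx : p ∈ metricProj X x) {v : RSpace d} (hv : ∀ i : Fin d, k ≤ (i : ℕ) → v i = 0) :
    inner ℝ (x - p) (fderiv ℝ φ.symm (φ p) v) = 0 := by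
  have hd := ((hasDerivAt_chart_symm_line hψ hp v).const_sub x).norm_sq
  have hmin : IsLocalMin (fun t : ℝ => ‖x - φ.symm (φ p + t • v)‖ ^ 2) 0 := by
    filter_upwards [eventually_chart_symm_mem hX hp hpx.1 hv] with t ht
    rw [zero_smul, add_zero, φ.left_inv hp, hpx.2, ← dist_eq_norm]
    exact pow_le_pow_left₀ Metric.infDist_nonneg (Metric.infDist_le_dist_of_mem ht) 2
  have h0 := hmin.hasDerivAt_eq_zero hd
  rw [zero_smul, add_zero, φ.left_inv hp, inner_neg_right] at h0
  linarith

/-- The Hessian vanishes on the tangent space of a manifold of critical points. -/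
lemma hessian_tangent_eq_zero {f : RSpace d → ℝ}
    (hX : ∀ y ∈ φ.source, y ∈ X ↔ ∀ i : Fin d, k ≤ (i : ℕ) → φ y i = 0)
    (hψ : ContDiffOn ℝ 2 φ.symm φ.target) {p : RSpace d} (hp : p ∈ φ.source) (hpX : p ∈ X)
    (hf : ContDiffAt ℝ 3 f p) (hcrit : ∀ y ∈ X, gradient f y = 0)
    {v : RSpace d} (hv : ∀ i : Fin d, k ≤ (i : ℕ) → v i = 0) :
    hessian f p (fderiv ℝ φ.symm (φ p) v) = 0 := by
  have hg : HasFDerivAt (gradient f) (hessian f p) (φ.symm (φ p + (0 : ℝ) • v)) := by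
    simpa [φ.left_inv hp] using (hasStrictFDerivAt_gradient hf).hasFDerivAt
  have h1 := hg.comp_hasDerivAt (0 : ℝ) (hasDerivAt_chart_symm_line hψ hp v)
  have h2 : HasDerivAt (gradient f ∘ fun t : ℝ => φ.symm (φ p + t • v)) 0 0 := by
    refine (hasDerivAt_const (0 : ℝ) (0 : RSpace d)).congr_of_eventuallyEq ?_
    filter_upwards [eventually_chart_symm_mem hX hp hpX hv] with t ht
    exact hcrit _ ht
  exact h1.unique h2

lemma fderiv_chart_symm_injective (hφ : ContDiffOn ℝ 2 φ φ.source)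
    (hψ : ContDiffOn ℝ 2 φ.symm φ.target) {p : RSpace d} (hp : p ∈ φ.source) :
    Function.Injective (fderiv ℝ φ.symm (φ p)) := by
  have h1 : HasFDerivAt φ (fderiv ℝ φ p) (φ.symm (φ p)) := by
    rw [φ.left_inv hp]
    exact ((hφ.contDiffAt (φ.open_source.mem_nhds hp)).differentiableAt
      (by norm_num)).hasFDerivAt
  have h2 := h1.comp (φ p) (hasFDerivAt_chart_symm hψ hp)
  have h3 : HasFDerivAt (φ ∘ φ.symm) (ContinuousLinearMap.id ℝ (RSpace d)) (φ p) := by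
    refine (hasFDerivAt_id (φ p)).congr_of_eventuallyEq ?_
    filter_upwards [φ.open_target.mem_nhds (φ.map_source hp)] with z hz
    exact φ.right_inv hz
  have h4 := h2.unique h3
  exact Function.LeftInverse.injective (g := fderiv ℝ φ p) fun v => congrArg (· v) h4

/-- The rank condition turns the inclusion of the tangent space in the kernel of the Hessian into
an equality. -/
lemma exists_tangent_of_hessian_eq_zero {f : RSpace d → ℝ} (hk : k ≤ d)
    (hX : ∀ y ∈ φ.source, y ∈ X ↔ ∀ i : Fin d, k ≤ (i : ℕ) → φ y i = 0)
    (hφ : ContDiffOn ℝ 2 φ φ.source) (hψ : ContDiffOn ℝ 2 φ.symm φ.target) {p : RSpace d}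
    (hp : p ∈ φ.source) (hpX : p ∈ X) (hf : ContDiffAt ℝ 3 f p)
    (hcrit : ∀ y ∈ X, gradient f y = 0)
    (hrank : Module.finrank ℝ (LinearMap.range (hessian f p : RSpace d →ₗ[ℝ] RSpace d)) = d - k)
    {u : RSpace d} (hu : hessian f p u = 0) :
    ∃ v : RSpace d, (∀ i : Fin d, k ≤ (i : ℕ) → v i = 0) ∧ fderiv ℝ φ.symm (φ p) v = u := by
  let J : (Fin k → ℝ) →ₗ[ℝ] RSpace d :=
    (fderiv ℝ φ.symm (φ p) : RSpace d →ₗ[ℝ] RSpace d) ∘ₗ firstCoords hk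
  have hJ : Function.Injective J :=
    (fderiv_chart_symm_injective hφ hψ hp).comp (firstCoords_injective hk)
  have hle : LinearMap.range J ≤ LinearMap.ker (hessian f p : RSpace d →ₗ[ℝ] RSpace d) := by
    rintro _ ⟨c, rfl⟩
    exact hessian_tangent_eq_zero hX hψ hp hpX hf hcrit fun i hi =>
      firstCoords_apply_eq_zero hk c hi
  have hker := LinearMap.finrank_range_add_finrank_ker
    (hessian f p : RSpace d →ₗ[ℝ] RSpace d)
  rw [hrank, finrank_euclideanSpace_fin] at hker
  have hJr : Module.finrank ℝ (LinearMap.range J) = k := by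
    rw [LinearMap.finrank_range_of_inj hJ, Module.finrank_fin_fun]
  have heq := Submodule.eq_of_le_of_finrank_le hle (by omega)
  have hmem : u ∈ LinearMap.ker (hessian f p : RSpace d →ₗ[ℝ] RSpace d) := hu
  rw [← heq] at hmem
  obtain ⟨c, hc⟩ := hmem
  exact ⟨firstCoords hk c, fun i hi => firstCoords_apply_eq_zero hk c hi, hc⟩

end Chart

lemma LRSI.mono {d : ℕ} {f : RSpace d → ℝ} {X : Set (RSpace d)} {r r' : ℝ} (h : r ≤ r')
    (hR : LRSI f X r') : LRSI f X r := by
  obtain ⟨μ, hμ, hR⟩ := hR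
  exact ⟨μ, hμ, fun x hx => hR x (Metric.cthickening_mono h X hx)⟩

/-- A Hessian of constant rank `d - k` along a compact `k`-dimensional manifold of minimizers
yields the restricted secant inequality close to it. Otherwise there are points `x_n` with nearest
points `p_n` violating it ever more strongly; a limit `u` of the unit vectors along `x_n - p_n` is
normal to the manifold and in the kernel of the Hessian, that is, tangent. -/
lemma HCPRC.exists_LRSI {d : ℕ} {f : RSpace d → ℝ} {fstar : ℝ} {X : Set (RSpace d)}
    (hf : LocLipGradient f) (hmin : IsLeast (Set.range f) fstar) (h : HCPRC f fstar X) :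
    ∃ r₀ : ℝ, 0 < r₀ ∧ LRSI f X r₀ := by
  obtain ⟨U, k, hU, hkd, hXU, hne, hXc, hman, hfU, hrank⟩ := h
  have hval : ∀ y ∈ X, f y = fstar := fun y hy => by rw [hXU] at hy; exact hy.1
  have hcrit : ∀ y ∈ X, gradient f y = 0 := fun y hy =>
    gradient_eq_zero_of_isLeast hmin (hval y hy)
  by_contra! hcon
  have hbad : ∀ n : ℕ, ∃ x p : RSpace d, x ∈ closedNbhd (1 / ((n : ℝ) + 1)) X ∧
      p ∈ metricProj X x ∧
      inner ℝ (gradient f x) (x - p) < 1 / ((n : ℝ) + 1) * ‖x - p‖ ^ 2 := by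
    intro n
    have hn : (0 : ℝ) < 1 / ((n : ℝ) + 1) := by positivity
    by_contra! hc
    exact hcon _ hn ⟨_, hn, fun x hx p hp => hc x p hx hp⟩
  choose x p hx hp hlt using hbad
  have hδ : Filter.Tendsto (fun n : ℕ => 1 / ((n : ℝ) + 1)) Filter.atTop (nhds 0) :=
    tendsto_one_div_add_atTop_nhds_zero_nat
  have hxp0 : ∀ n, x n - p n ≠ 0 := by
    intro n h0
    have := hlt n
    rw [h0] at this
    simp at this
  set u : ℕ → RSpace d := fun n => ‖x n - p n‖⁻¹ • (x n - p n) with hu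
  have hsphere : ∀ n, u n ∈ Metric.sphere (0 : RSpace d) 1 := by
    intro n
    have : ‖x n - p n‖ ≠ 0 := norm_ne_zero_iff.2 (hxp0 n)
    simp [hu, norm_smul, this]
  obtain ⟨⟨q, w⟩, ⟨hqX, hw⟩, s, hs, hlim⟩ :=
    (hXc.prod (isCompact_sphere (0 : RSpace d) 1)).tendsto_subseq
      (x := fun n => (p n, u n)) fun n => ⟨(hp n).1, hsphere n⟩
  have hps : Filter.Tendsto (fun n => p (s n)) Filter.atTop (nhds q) :=
    (continuous_fst.tendsto _).comp hlim
  have hus : Filter.Tendsto (fun n => u (s n)) Filter.atTop (nhds w) :=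
    (continuous_snd.tendsto _).comp hlim
  have hδs := hδ.comp hs.tendsto_atTop
  have hdiff : Filter.Tendsto (fun n => x (s n) - p (s n)) Filter.atTop (nhds 0) := by
    refine squeeze_zero_norm (fun n => ?_) hδs
    rw [(hp (s n)).2]
    exact (mem_closedNbhd_iff hne Nat.one_div_pos_of_nat.le).1 (hx (s n))
  have hxs : Filter.Tendsto (fun n => x (s n)) Filter.atTop (nhds q) := by
    simpa using hdiff.add hps
  have hqU : q ∈ U := by rw [hXU] at hqX; exact hqX.2
  have hfq : ContDiffAt ℝ 3 f q := hfU.contDiffAt (hU.mem_nhds hqU)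
  -- the quadratic form of the Hessian is not positive at the limit direction
  have hquad : inner ℝ (hessian f q w) w ≤ 0 := by
    refine le_of_forall_pos_le_add fun c hc => ?_
    rw [zero_add]
    have hlo := ((hasStrictFDerivAt_gradient hfq).isLittleO.comp_tendsto
      (hxs.prodMk_nhds hps)).def hc
    have hlim1 : Filter.Tendsto (fun n => inner ℝ (hessian f q (u (s n))) (u (s n)))
        Filter.atTop (nhds (inner ℝ (hessian f q w) w)) :=
      (((hessian f q).continuous.tendsto w).comp hus).inner hus
    have hlim2 : Filter.Tendsto (fun n => 1 / ((s n : ℝ) + 1) + c) Filter.atTop (nhds c) := by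
      simpa using hδs.add_const c
    refine le_of_tendsto_of_tendsto hlim1 hlim2 ?_
    filter_upwards [hlo] with n hn
    set y := x (s n) - p (s n) with hy
    have hy0 : 0 < ‖y‖ := norm_pos_iff.2 (hxp0 (s n))
    simp only [Function.comp_apply, hcrit _ (hp (s n)).1, sub_zero] at hn
    have h1 : inner ℝ (hessian f q y) y ≤ (1 / ((s n : ℝ) + 1) + c) * ‖y‖ ^ 2 := by
      have h2 := (neg_le_abs _).trans
        (abs_real_inner_le_norm (gradient f (x (s n)) - hessian f q y) y)
      rw [inner_sub_left] at h2
      have h3 : ‖gradient f (x (s n)) - hessian f q y‖ * ‖y‖ ≤ c * ‖y‖ * ‖y‖ := by gcongr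
      have h4 := hlt (s n)
      rw [← hy] at h4
      linarith
    have h5 : inner ℝ (hessian f q (u (s n))) (u (s n)) =
        inner ℝ (hessian f q y) y / ‖y‖ ^ 2 := by
      simp only [hu, ← hy, map_smul, inner_smul_left, inner_smul_right, conj_trivial]
      field_simp
    rw [h5, div_le_iff₀ (by positivity)]
    exact h1
  have hker : hessian f q w = 0 := apply_eq_zero_of_inner_self_nonpos (inner_hessian_comm hfq)
    (inner_hessian_self_nonneg hf.1 hfq fun y => by
      rw [hval q hqX]; exact hmin.2 (Set.mem_range_self y)) hquad
  obtain ⟨φ, hqφ, hφ, hψ, hφX⟩ := hman q hqX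
  obtain ⟨v, hv, hvw⟩ := exists_tangent_of_hessian_eq_zero hkd.le hφX hφ hψ hqφ hqX hfq hcrit
    (hrank q hqX) hker
  -- normality passes to the limit
  have hnormal : inner ℝ w (fderiv ℝ φ.symm (φ q) v) = 0 := by
    have hcont : ContinuousAt (fun y => fderiv ℝ φ.symm (φ y) v) q := by
      have h1 : ContinuousAt (fderiv ℝ φ.symm) (φ q) :=
        ((hψ.contDiffAt (φ.open_target.mem_nhds (φ.map_source hqφ))).fderiv_right
          (m := 1) (by norm_num)).continuousAt
      exact (h1.comp (φ.continuousAt hqφ)).clm_apply continuousAt_const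
    have hl := hus.inner (𝕜 := ℝ) (hcont.tendsto.comp hps)
    refine tendsto_nhds_unique hl (tendsto_const_nhds.congr' ?_)
    filter_upwards [hps.eventually (φ.open_source.mem_nhds hqφ)] with n hn
    rw [hu, Function.comp_apply, inner_smul_left,
      inner_sub_tangent_eq_zero hφX hψ hn (hp (s n)) hv, mul_zero]
  rw [hvw, real_inner_self_eq_norm_sq] at hnormal
  have : ‖w‖ = 1 := by simpa using hw
  rw [this] at hnormal
  norm_num at hnormal

theorem theorem2 {d : ℕ} (f : RSpace d → ℝ) (fstar : ℝ) (X : Set (RSpace d))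
    (hf : LocLipGradient f) (hmin : IsLeast (Set.range f) fstar)
    (hXc : IsCompact X) (hX : X ⊆ {y | f y = fstar}) :
    -- everything but the HCPRC case, for a fixed radius `r`
    (∀ (Ω : Type*) [MeasurableSpace Ω] (P : Measure Ω) [IsProbabilityMeasure P]
        (S : Type*) [MeasurableSpace S] (ν : Measure S) [IsProbabilityMeasure ν]
        (ξ : RSpace d → S → RSpace d) (I : ℕ) (a : ℕ → ℝ) (x₁ : RSpace d)
        (x : ℕ → Ω → RSpace d) (r L σ : ℝ),
        0 < r → SGDSetting P ν f X r L σ ξ I a x₁ x →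
      -- the general concentration inequality
      (∀ h : RSpace d → ℝ, NNS f X r h → ∀ ε : ℝ, 0 < ε → ∀ (N : ℕ) (hN : 1 ≤ N),
        P.real {ω | minUpTo (fun n => h (x n ω)) N hN > ε} ≤
          1 / ε * (lyapunovInit X L σ I a x₁ (N + 1) /
              (2 * ∑ n ∈ Finset.Icc 1 N, a n / bSeq L a (n + 1)))
            + exitBound X r L σ I a x₁ (N + 1)) ∧
      -- polynomially decreasing learning rates
      (∀ a₀ β : ℝ, 0 < a₀ → 1 / 2 < β → β < 1 → (∀ n : ℕ, 1 ≤ n → a n = a₀ / (n : ℝ) ^ β) →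
        (WQC f fstar X r → ∃ K : ℝ, ∀ ε : ℝ, 0 < ε → ∀ (N : ℕ) (hN : 1 ≤ N),
          P.real {ω | minUpTo (fun n => f (x n ω)) N hN - fstar > ε} ≤
            K / (ε * (N : ℝ) ^ (1 - β)) + exitBound X r L σ I a x₁ (N + 1)) ∧
        (LRSI f X r → ∃ K : ℝ, ∀ ε : ℝ, 0 < ε → ∀ N : ℕ, 1 ≤ N →
          P.real {ω | f (x N ω) - fstar > ε} ≤
            K / (ε * (N : ℝ) ^ β) + exitBound X r L σ I a x₁ (N + 1)))) ∧
    -- the HCPRC case, for every sufficiently small radius `r`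
    (HCPRC f fstar X → ∃ r₀ : ℝ, 0 < r₀ ∧
      ∀ (Ω : Type*) [MeasurableSpace Ω] (P : Measure Ω) [IsProbabilityMeasure P]
        (S : Type*) [MeasurableSpace S] (ν : Measure S) [IsProbabilityMeasure ν]
        (ξ : RSpace d → S → RSpace d) (I : ℕ) (a : ℕ → ℝ) (x₁ : RSpace d)
        (x : ℕ → Ω → RSpace d) (r L σ : ℝ),
        0 < r → r ≤ r₀ → SGDSetting P ν f X r L σ ξ I a x₁ x →
      ∀ a₀ β : ℝ, 0 < a₀ → 1 / 2 < β → β < 1 → (∀ n : ℕ, 1 ≤ n → a n = a₀ / (n : ℝ) ^ β) →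
        ∃ K : ℝ, ∀ ε : ℝ, 0 < ε → ∀ N : ℕ, 1 ≤ N →
          P.real {ω | f (x N ω) - fstar > ε} ≤
            K / (ε * (N : ℝ) ^ β) + exitBound X r L σ I a x₁ (N + 1)) := by
  refine ⟨fun Ω _ P _ S _ ν _ ξ I a x₁ x r L σ hr hs => ⟨fun h hh ε hε N hN =>
    hs.measureReal_minUpTo_le hf hmin hXc hX hr hh hε hN, fun a₀ β ha₀ hβ hβ1 ha =>
    ⟨hs.exists_bound_of_WQC hf hmin hXc hX hr ha₀ (by linarith) ha,
      hs.exists_bound_of_LRSI hf hmin hXc hX hr ha₀ (by linarith) hβ1 ha⟩⟩, fun hH => ?_⟩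
  obtain ⟨r₀, hr₀, hR⟩ := hH.exists_LRSI hf hmin
  exact ⟨r₀, hr₀, fun Ω _ P _ S _ ν _ ξ I a x₁ x r L σ hr hrr hs a₀ β ha₀ hβ hβ1 ha =>
    hs.exists_bound_of_LRSI hf hmin hXc hX hr ha₀ (by linarith) hβ1 ha (hR.mono hrr)⟩
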